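/- Let $n\ge 0$, $[n]=\{1,\dots,n\}$, and let $\lambda,y,w$, $\mathbf z=(z_1,\dots,z_n)$ be variables. Let $\mathcal L=\mathcal L_{\lambda,(\mathbf z,y)}\subset\mathbb C(\lambda,\mathbf z,y)$ be the algebra generated by $\mathbb C(\mathbf z,y)$, $\lambda$ and the elements $(\lambda+ly)^{-1}$, $l\in\mathbb Z$. Let $v_1,v_2$ be the standard basis of $\mathbb C^2$, $V=(\mathbb C^2)^{\otimes n}\otimes\mathcal L$, and $v_I=v_{i_1}\otimes\dots\otimes v_{i_n}$ for $I\subset[n]$, where $i_j=1$ if $j\in I$ and $i_j=2$ if $j\in\bar I=[n]-I$. **L-operator.** In the basis $v_1\otimes v_1,v_1\otimes v_2,v_2\otimes v_1,v_2\otimes v_2$ of $\mathbb C^2\otimes\mathbb C^2$ let $$R(\lambda,z,y)=\begin{pmatrix}1&0&0&0\\0&\frac{(\lambda+y)z}{\lambda(z-y)}&-\frac{(\lambda+z)y}{\lambda(z-y)}&0\\0&-\frac{(\lambda-z)y}{\lambda(z-y)}&\frac{(\lambda-y)z}{\lambda(z-y)}&0\\0&0&0&1\end{pmatrix}.$$ Number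 the factors of $\mathbb C^2\otimes(\mathbb C^2)^{\otimes n}$ by $0,1,\dots,n$; let $R^{(0,j)}$ be $R$ acting in the factors $0,j$, and let $h^{(j)}$ act on the $j$-th factor by $hv_1=v_1$, $hv_2=-v_2$. Let $$L(\lambda,w,y)=R^{(0,1)}\Bigl(\lambda-y\sum_{j=2}^nh^{(j)},w-z_1,y\Bigr)R^{(0,2)}\Bigl(\lambda-y\sum_{j=3}^nh^{(j)},w-z_2,y\Bigr)\cdots R^{(0,n)}(\lambda,w-z_n,y),$$ viewed as a $2\times2$ matrix $(L_{ij}(\lambda,w,y))$ with entries acting on $(\mathbb C^2)^{\otimes n}$ and expanded in powers of $w^{-1}$. With $\delta:\zeta(\lambda)\mapsto\zeta(\lambda+y)$ on $V$, put $\tilde L_{11}=L_{11}\delta^{-1}$, $\tilde L_{21}=L_{21}\delta^{-1}$, $\tilde L_{12}=L_{12}\delta$, $\tilde L_{22}=L_{22}\delta$; these are power series in $w^{-1}$ whose coefficients are $\mathbb C$-linear operators on $V$. **Vectors $\xi_I$.** For $i\in I$ let $w(i,I)=\#\{j\in I: j>i\}-\#\{j\in\bar I: j>i\}$. For $I=\{i_1<\dots<i_k\}$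 and $\mathbf t=(t_1,\dots,t_k)$ let $l_I(r,a)$ be $t_r-z_a+y$ if $a<i_r$, $\lambda+t_r-z_a-w(i_r,I)y$ if $a=i_r$, and $t_r-z_a$ if $a>i_r$. Let $$W_I(\lambda,\mathbf t,\mathbf z,y)=y^k\sum_{\tau\in S_k}\tau\Bigl(\prod_{r=1}^k\prod_{a=1}^nl_I(r,a)\prod_{1\le a<b\le k}\frac{t_a-t_b+y}{t_a-t_b}\Bigr),$$ where $\tau$ substitutes $t_{\tau(a)}$ for $t_a$. With $e_k=\prod_{a,b=1}^k(t_a-t_b+y)$ and $s_0(J)=\{n+1-j: j\in J\}$ put, for $|J|=k$, $$\tilde W^-_J(\lambda,\mathbf t,\mathbf z,y)=\frac{(-1)^k}{e_k}W_{s_0(J)}\bigl(-\lambda-(n-2k)y,\mathbf t,(z_n,\dots,z_1),y\bigr).$$ With $\mathbf z_I=(z_{i_1},\dots,z_{i_k})$ and $Q_I=\prod_{a\in I}\prod_{b\in\bar I}(z_a-z_b+y)$ put $$\xi_I=\frac1{Q_I}\sum_{|J|=|I|}\tilde W^-_J(\lambda,\mathbf z_I,\mathbf z,y)\,v_J\in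 V.$$ **Proposition.** The series $\tilde L_{22}$ is invertible. Let $\tilde F(w,y)=\tilde L_{12}\circ\tilde L_{22}^{-1}$ and $\tilde E(w,y)=\tilde L_{22}^{-1}\circ\tilde L_{21}$. Then for every $k$ and every $I\subset[n]$ with $|I|=k$, $$\tilde F(w,y)\,\xi_I=c_F\sum_{i\in I}\frac{\xi_{I-\{i\}}}{w-z_i}\,(\lambda+w-z_i+y(n-2k+1))\prod_{s\in I-\{i\}}\frac{z_i-z_s-y}{z_i-z_s},$$ $$\tilde E(w,y)\,\xi_I=c_E\sum_{i\in\bar I}\frac{\xi_{I\cup\{i\}}}{w-z_i}\,(\lambda-w+z_i-y)\prod_{s\in\bar I-\{i\}}\frac{z_s-z_i-y}{z_s-z_i},$$ where $c_F=-y$ and $c_E=\dfrac{-y}{(\lambda-y)(\lambda-2y)}$, and the right-hand sides are expanded in powers of $w^{-1}$. -/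

import Mathlib

open scoped BigOperators

noncomputable section

namespace DynGL2

/-- The variables `λ`, `y`, `z_1, …, z_n`. -/
inductive Var (n : ℕ) : Type
  | lam : Var n
  | y : Var n
  | z : Fin n → Var n

/-- The field `ℂ(λ, z_1, …, z_n, y)` of rational functions. -/
def RatFun (n : ℕ) : Type := FractionRing (MvPolynomial (Var n) ℂ)

instance (n : ℕ) : Field (RatFun n) :=
  inferInstanceAs (Field (FractionRing (MvPolynomial (Var n) ℂ)))

instance (n : ℕ) : Algebra (MvPolynomial (Var n) ℂ) (RatFun n) :=
  inferInstanceAs (Algebra (MvPolynomial (Var n) ℂ) (FractionRing (MvPolynomial (Var n) ℂ)))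

instance (n : ℕ) : IsFractionRing (MvPolynomial (Var n) ℂ) (RatFun n) :=
  inferInstanceAs (IsFractionRing (MvPolynomial (Var n) ℂ) (FractionRing (MvPolynomial (Var n) ℂ)))

instance (n : ℕ) : Algebra ℂ (RatFun n) :=
  inferInstanceAs (Algebra ℂ (FractionRing (MvPolynomial (Var n) ℂ)))

instance (n : ℕ) : IsScalarTower ℂ (MvPolynomial (Var n) ℂ) (RatFun n) :=
  inferInstanceAs (IsScalarTower ℂ (MvPolynomial (Var n) ℂ) (FractionRing (MvPolynomial (Var n) ℂ)))

/-- A variable, as a rational function. -/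
def rvar {n : ℕ} (v : Var n) : RatFun n := algebraMap (MvPolynomial (Var n) ℂ) (RatFun n) (MvPolynomial.X v)

/-- `λ` -/
def lamK (n : ℕ) : RatFun n := rvar Var.lam
/-- `y` -/
def yK (n : ℕ) : RatFun n := rvar Var.y
/-- `z_i` -/
def zK {n : ℕ} (i : Fin n) : RatFun n := rvar (Var.z i)

/-- The subfield `ℂ(z_1, …, z_n, y)` of rational functions in `z, y`. -/
def zyField (n : ℕ) : IntermediateField ℂ (RatFun n) :=
  IntermediateField.adjoin ℂ ({yK n} ∪ Set.range (zK (n := n)))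

/-- The algebra `ℒ_{λ,(z,y)}`, generated by all rational functions in `z, y`, by `λ`, and by the
inverses of `λ + l y`, `l ∈ ℤ`. -/
def coeffAlg (n : ℕ) : Subalgebra ℂ (RatFun n) :=
  Algebra.adjoin ℂ ((zyField n : Set (RatFun n)) ∪ {lamK n} ∪
    Set.range (fun l : ℤ => (lamK n + (l : RatFun n) * yK n)⁻¹))

/-! ### The shift `δ : λ ↦ λ + y` -/

/-- `λ ↦ λ + c y`, on polynomials. -/
def shiftPoly (n : ℕ) (c : ℂ) : MvPolynomial (Var n) ℂ →ₐ[ℂ] MvPolynomial (Var n) ℂ :=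
  MvPolynomial.aeval (fun v => match v with
    | Var.lam => MvPolynomial.X Var.lam + MvPolynomial.C c * MvPolynomial.X Var.y
    | Var.y => MvPolynomial.X Var.y
    | Var.z i => MvPolynomial.X (Var.z i))

theorem shiftPoly_comp (n : ℕ) (c d : ℂ) (h : c + d = 0) :
    (shiftPoly n c).comp (shiftPoly n d) = AlgHom.id ℂ _ := by
  have h' : (MvPolynomial.C c + MvPolynomial.C d : MvPolynomial (Var n) ℂ) = 0 := by
    rw [← MvPolynomial.C_add, h, MvPolynomial.C_0]
  apply MvPolynomial.algHom_ext
  intro v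
  cases v with
  | lam =>
    simp [shiftPoly, MvPolynomial.algebraMap_eq]
    linear_combination (MvPolynomial.X Var.y : MvPolynomial (Var n) ℂ) * h'
  | y => simp [shiftPoly]
  | z i => simp [shiftPoly]

/-- The automorphism `λ ↦ λ + y` of the polynomial ring. -/
def shiftPolyEquiv (n : ℕ) : MvPolynomial (Var n) ℂ ≃ₐ[ℂ] MvPolynomial (Var n) ℂ :=
  AlgEquiv.ofAlgHom (shiftPoly n 1) (shiftPoly n (-1))
    (shiftPoly_comp n 1 (-1) (by ring)) (shiftPoly_comp n (-1) 1 (by ring))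

/-- The automorphism `f(λ, z, y) ↦ f(λ + y, z, y)` of the field of rational functions. -/
def shiftK (n : ℕ) : RatFun n ≃ₐ[ℂ] RatFun n :=
  IsFractionRing.fieldEquivOfAlgEquiv ℂ (RatFun n) (RatFun n) (shiftPolyEquiv n)

theorem shiftK_rvar {n : ℕ} (v : Var n) :
    shiftK n (rvar v) = algebraMap _ _ (shiftPoly n 1 (MvPolynomial.X v)) := by
  simp [shiftK, rvar, shiftPolyEquiv]

theorem shiftK_lam (n : ℕ) : shiftK n (lamK n) = lamK n + yK n := by
  rw [lamK, shiftK_rvar]; simp [shiftPoly, rvar, yK]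

theorem shiftK_y (n : ℕ) : shiftK n (yK n) = yK n := by
  rw [yK, shiftK_rvar]; simp [shiftPoly, rvar]

theorem shiftK_z {n : ℕ} (i : Fin n) : shiftK n (zK i) = zK i := by
  rw [zK, shiftK_rvar]; simp [shiftPoly, rvar]

theorem shiftK_zy {n : ℕ} {f : RatFun n} (hf : f ∈ zyField n) : shiftK n f = f := by
  induction hf using IntermediateField.adjoin_induction with
  | mem x hx =>
    rcases hx with hx | ⟨i, rfl⟩
    · rw [Set.mem_singleton_iff.1 hx, shiftK_y]
    · exact shiftK_z i
  | algebraMap x => exact (shiftK n).commutes x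
  | add x y _ _ hx hy => rw [map_add, hx, hy]
  | inv x _ hx => rw [map_inv₀, hx]
  | mul x y _ _ hx hy => rw [map_mul, hx, hy]

theorem zy_mem {n : ℕ} {f : RatFun n} (hf : f ∈ zyField n) : f ∈ coeffAlg n :=
  Algebra.subset_adjoin (Or.inl (Or.inl hf))

theorem yK_zy (n : ℕ) : yK n ∈ zyField n :=
  IntermediateField.subset_adjoin _ _ (Or.inl rfl)

theorem zK_zy {n : ℕ} (i : Fin n) : zK i ∈ zyField n :=
  IntermediateField.subset_adjoin _ _ (Or.inr ⟨i, rfl⟩)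

theorem lam_mem (n : ℕ) : lamK n ∈ coeffAlg n :=
  Algebra.subset_adjoin (Or.inl (Or.inr rfl))

theorem inv_mem {n : ℕ} (l : ℤ) : (lamK n + (l : RatFun n) * yK n)⁻¹ ∈ coeffAlg n :=
  Algebra.subset_adjoin (Or.inr ⟨l, rfl⟩)

theorem shiftK_map (n : ℕ) :
    (coeffAlg n).map (shiftK n : RatFun n →ₐ[ℂ] RatFun n) = coeffAlg n := by
  apply le_antisymm
  · rw [coeffAlg, AlgHom.map_adjoin, Algebra.adjoin_le_iff]
    rintro _ ⟨f, (hf | hf) | ⟨l, rfl⟩, rfl⟩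
    · rw [AlgEquiv.coe_toAlgHom, shiftK_zy hf]; exact zy_mem hf
    · rw [Set.mem_singleton_iff.1 hf, AlgEquiv.coe_toAlgHom, shiftK_lam]
      exact add_mem (lam_mem n) (zy_mem (yK_zy n))
    · have := inv_mem (n := n) (l + 1)
      simp only [AlgEquiv.coe_toAlgHom, map_inv₀, map_add, map_mul, map_intCast, shiftK_lam,
        shiftK_y]
      have e : lamK n + yK n + (l : RatFun n) * yK n
          = lamK n + ((l + 1 : ℤ) : RatFun n) * yK n := by push_cast; ring
      rw [e]
      exact this
  · conv_lhs => rw [coeffAlg]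
    rw [Algebra.adjoin_le_iff]
    rintro f ((hf | hf) | ⟨l, rfl⟩)
    · exact ⟨f, zy_mem hf, shiftK_zy hf⟩
    · refine ⟨lamK n - yK n, (coeffAlg n).sub_mem (lam_mem n) (zy_mem (yK_zy n)), ?_⟩
      rw [Set.mem_singleton_iff.1 hf]
      simp [shiftK_lam, shiftK_y]
    · refine ⟨_, inv_mem (n := n) (l - 1), ?_⟩
      simp only [RingHom.coe_coe, AlgEquiv.coe_toAlgHom, map_inv₀, map_add, map_mul, map_intCast,
        shiftK_lam, shiftK_y]
      congr 1
      push_cast; ring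

/-- The shift operator `δ` on `ℒ_{λ,(z,y)}`. -/
def shift (n : ℕ) : coeffAlg n ≃ₐ[ℂ] coeffAlg n :=
  ((shiftK n).subalgebraMap (coeffAlg n)).trans (Subalgebra.equivOfEq _ _ (shiftK_map n))

/-! ### The dynamical R-matrix and the L-operator -/

/-- The rational dynamical R-matrix, as a matrix acting on column vectors in the basis
`v_a ⊗ v_b`; the values `0, 1 : Fin 2` stand for the indices `1, 2`. -/
def Rmat {𝔽 : Type*} [Field 𝔽] (lam z y : 𝔽) : Matrix (Fin 2 × Fin 2) (Fin 2 × Fin 2) 𝔽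
  | (0, 0), (0, 0) => 1
  | (0, 1), (0, 1) => (lam + y) * z / (lam * (z - y))
  | (0, 1), (1, 0) => -((lam + z) * y / (lam * (z - y)))
  | (1, 0), (0, 1) => -((lam - z) * y / (lam * (z - y)))
  | (1, 0), (1, 0) => (lam - y) * z / (lam * (z - y))
  | (1, 1), (1, 1) => 1
  | _, _ => 0

/-- The weight `h(v_1) = 1`, `h(v_2) = -1`. -/
def wt : Fin 2 → ℤ := ![1, -1]

/-- Labels of the standard basis of `(ℂ²)^{⊗ n}`: the label `s` stands for
`v_{s 1} ⊗ ⋯ ⊗ v_{s n}`. -/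
abbrev Conf (n : ℕ) : Type := Fin n → Fin 2

/-- The operator `R^{(0,j)}(lam - y ∑_{m > j} h^{(m)}, x, y)` on `ℂ² ⊗ (ℂ²)^{⊗ n}`, where the
auxiliary factor has number `0`. -/
def R0 {𝔽 : Type*} [Field 𝔽] {n : ℕ} (lam y : 𝔽) (x : 𝔽) (j : Fin n) :
    Matrix (Fin 2 × Conf n) (Fin 2 × Conf n) 𝔽 := fun p q =>
  if ∀ m, m ≠ j → p.2 m = q.2 m then
    Rmat (lam - y * ((∑ m ∈ Finset.Ioi j, wt (q.2 m) : ℤ) : 𝔽)) x y (p.1, p.2 j) (q.1, q.2 j)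
  else 0

/-- `R^{(0,1)}(λ - y ∑_{m ≥ 2} h^{(m)}, w - z_1, y) ⋯ R^{(0,n)}(λ, w - z_n, y)` -/
def Lmat {𝔽 : Type*} [Field 𝔽] {n : ℕ} (lam w y : 𝔽) (z : Fin n → 𝔽) :
    Matrix (Fin 2 × Conf n) (Fin 2 × Conf n) 𝔽 :=
  (List.ofFn fun j : Fin n => R0 lam y (w - z j) j).prod

/-- Laurent series in `w⁻¹` over `ℂ(λ, z, y)`: the coefficient with number `s` is that of `w^{-s}`. -/
abbrev WSeries (n : ℕ) : Type := LaurentSeries (RatFun n)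

/-- The spectral variable `w`. -/
def wS (n : ℕ) : WSeries n := HahnSeries.single (-1 : ℤ) (1 : RatFun n)

/-- A rational function in `λ, z, y`, as a constant series. -/
def cS {n : ℕ} : RatFun n →+* WSeries n := HahnSeries.C

/-- Entries of the L-operator `L(λ, w, y)` of `V(z_1) ⊗ ⋯ ⊗ V(z_n)`, expanded at `w = ∞`:
`Lentry i j t s` is the coefficient of `v_t` in `L_{ij}(λ, w, y) v_s`. -/
def Lentry {n : ℕ} (i j : Fin 2) (t s : Conf n) : WSeries n :=
  Lmat (cS (lamK n)) (wS n) (cS (yK n)) (fun a => cS (zK a)) (i, t) (j, s)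

/-- Power series in `w⁻¹` with coefficients in `ℒ_{λ,(z,y)}`. -/
def coeffSeries (n : ℕ) : Subring (WSeries n) :=
  ((HahnSeries.ofPowerSeries ℤ (RatFun n)).comp
    (PowerSeries.map (coeffAlg n).val.toRingHom)).range

theorem cS_mem {n : ℕ} {f : RatFun n} (hf : f ∈ coeffAlg n) : cS f ∈ coeffSeries n :=
  ⟨PowerSeries.C (⟨f, hf⟩ : coeffAlg n), by simp [cS]⟩

theorem mul_series {n : ℕ} (a : RatFun n) :
    (wS n - cS a) * HahnSeries.ofPowerSeries ℤ (RatFun n)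
      (PowerSeries.X * PowerSeries.mk fun s => a ^ s) = 1 := by
  have h1 : (1 - PowerSeries.C a * PowerSeries.X) * (PowerSeries.mk fun s => a ^ s) = 1 := by
    ext s
    cases s with
    | zero => simp [sub_mul, mul_assoc]
    | succ s =>
      simp [sub_mul, mul_assoc, PowerSeries.coeff_succ_X_mul, PowerSeries.coeff_one, pow_succ']
  have h2 : wS n * HahnSeries.ofPowerSeries ℤ (RatFun n) PowerSeries.X = 1 := by
    simp [wS, HahnSeries.ofPowerSeries_X]
  have h3 := congrArg (HahnSeries.ofPowerSeries ℤ (RatFun n)) h1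
  simp only [map_mul, map_sub, map_one, HahnSeries.ofPowerSeries_C] at h3 ⊢
  change (wS n - HahnSeries.C a) * _ = 1
  linear_combination h3 +
    (HahnSeries.ofPowerSeries ℤ (RatFun n) (PowerSeries.mk fun s => a ^ s)) * h2

theorem inv_mem_series {n : ℕ} {a : RatFun n} (ha : a ∈ coeffAlg n) :
    (wS n - cS a)⁻¹ ∈ coeffSeries n := by
  rw [inv_eq_of_mul_eq_one_right (mul_series a)]
  refine ⟨PowerSeries.X * PowerSeries.mk fun s => (⟨a, ha⟩ : coeffAlg n) ^ s, ?_⟩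
  have h : PowerSeries.map (coeffAlg n).val.toRingHom
      (PowerSeries.mk fun s => (⟨a, ha⟩ : coeffAlg n) ^ s) = PowerSeries.mk fun s => a ^ s := by
    ext s
    simp
  rw [RingHom.comp_apply, map_mul, PowerSeries.map_X, h]

theorem Rmat_mem {n : ℕ} (l : ℤ) {b : RatFun n} (hb : b ∈ zyField n) (p q : Fin 2 × Fin 2) :
    Rmat (cS (lamK n) - cS (yK n) * (l : WSeries n)) (wS n - cS b) (cS (yK n)) p q
      ∈ coeffSeries n := by
  have hl : cS (lamK n) - cS (yK n) * (l : WSeries n) = cS (lamK n + ((-l : ℤ) : RatFun n) * yK n) := by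
    simp only [map_add, map_mul, map_intCast]
    push_cast; ring
  have hx : wS n - cS b - cS (yK n) = wS n - cS (b + yK n) := by
    rw [map_add]; ring
  have hy := yK_zy n
  have m1 : (wS n - cS (b + yK n))⁻¹ ∈ coeffSeries n :=
    inv_mem_series (zy_mem (add_mem hb hy))
  have m2 : (cS (lamK n + ((-l : ℤ) : RatFun n) * yK n))⁻¹ ∈ coeffSeries n := by
    rw [← map_inv₀]; exact cS_mem (inv_mem _)
  have m3 : cS (lamK n + ((-l : ℤ) : RatFun n) * yK n) ∈ coeffSeries n :=
    cS_mem (Subalgebra.add_mem _ (lam_mem n)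
      (Subalgebra.mul_mem _ (Subalgebra.intCast_mem _ _) (zy_mem hy)))
  have m4 : cS (yK n) ∈ coeffSeries n := cS_mem (zy_mem hy)
  have h0 : wS n - cS (b + yK n) ≠ 0 := left_ne_zero_of_mul_eq_one (mul_series (b + yK n))
  have hb' : wS n - cS b = (wS n - cS (b + yK n)) + cS (yK n) := by rw [map_add]; ring
  have m5 : (wS n - cS b) * (wS n - cS (b + yK n))⁻¹ ∈ coeffSeries n := by
    rw [hb', add_mul, mul_inv_cancel₀ h0]
    exact add_mem (one_mem _) (mul_mem m4 m1)
  rw [hl]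
  generalize hL : cS (lamK n + ((-l : ℤ) : RatFun n) * yK n) = L at m2 m3
  obtain ⟨p1, p2⟩ := p
  obtain ⟨q1, q2⟩ := q
  fin_cases p1 <;> fin_cases p2 <;> fin_cases q1 <;> fin_cases q2 <;>
    simp only [Rmat, Fin.zero_eta, Fin.mk_one, Fin.isValue, hx] <;>
    first
    | exact zero_mem _
    | exact one_mem _
    | skip
  · convert mul_mem (mul_mem (add_mem m3 m4) m2) m5 using 1
    rw [div_eq_mul_inv, mul_inv]; ring
  · refine neg_mem ?_
    convert mul_mem (mul_mem m4 m2) (add_mem (mul_mem m3 m1) m5) using 1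
    rw [div_eq_mul_inv, mul_inv]; ring
  · refine neg_mem ?_
    convert mul_mem (mul_mem m4 m2) (sub_mem (mul_mem m3 m1) m5) using 1
    rw [div_eq_mul_inv, mul_inv]; ring
  · convert mul_mem (mul_mem (sub_mem m3 m4) m2) m5 using 1
    rw [div_eq_mul_inv, mul_inv]; ring

theorem Lentry_mem {n : ℕ} (i j : Fin 2) (t s : Conf n) :
    Lentry i j t s ∈ coeffSeries n := by
  have key : Lmat (cS (lamK n)) (wS n) (cS (yK n)) (fun a => cS (zK a)) ∈
      (coeffSeries n).matrix := by
    refine list_prod_mem fun M hM => ?_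
    obtain ⟨a, rfl⟩ := (List.mem_ofFn' _ _).1 hM
    intro p q
    simp only [R0]
    split_ifs
    · exact Rmat_mem _ (zK_zy a) _ _
    · exact zero_mem _
  exact key (i, t) (j, s)

/-- The entries of the L-operator have no positive powers of `w`. -/
theorem Lentry_coeff_neg {n : ℕ} (i j : Fin 2) (t s : Conf n) {m : ℤ} (hm : m < 0) :
    (Lentry i j t s).coeff m = 0 := by
  obtain ⟨f, hf⟩ := Lentry_mem i j t s
  rw [← hf, RingHom.comp_apply, HahnSeries.ofPowerSeries_apply]
  refine HahnSeries.embDomain_of_notMem_range ?_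
  rintro ⟨k, hk⟩
  have : (k : ℤ) = m := hk
  omega

theorem Lentry_coeff_mem {n : ℕ} (i j : Fin 2) (t s : Conf n) (m : ℕ) :
    (Lentry i j t s).coeff (m : ℤ) ∈ coeffAlg n := by
  obtain ⟨f, hf⟩ := Lentry_mem i j t s
  rw [← hf, RingHom.comp_apply, HahnSeries.ofPowerSeries_apply_coeff]
  simp

/-! ### The operator algebra -/

/-- The space `V(z_1) ⊗ ⋯ ⊗ V(z_n) = (ℂ²)^{⊗ n} ⊗ ℒ_{λ,(z,y)}`, in coordinates with respect to
the standard basis of `(ℂ²)^{⊗ n}`. -/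
abbrev V (n : ℕ) : Type := Conf n → coeffAlg n

/-- The coefficient of `w^{-m}` in the entry `(t, s)` of `L_{ij}(λ, w, y)`. -/
def Lcoeff {n : ℕ} (i j : Fin 2) (m : ℕ) (t s : Conf n) : coeffAlg n :=
  ⟨(Lentry i j t s).coeff (m : ℤ), Lentry_coeff_mem i j t s m⟩

/-- The shift with which `L_{ij}` is composed: `δ⁻¹` for `j = 1` and `δ` for `j = 2`. -/
def shiftFor (n : ℕ) (j : Fin 2) : coeffAlg n ≃ₐ[ℂ] coeffAlg n :=
  if j = 0 then (shift n).symm else shift n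

/-- The difference operator `L̃_{ij,m}` on `V(z_1) ⊗ ⋯ ⊗ V(z_n)`: the matrix `L_{ij,m}(λ, y)`
composed with `δ⁻¹` if `j = 1` and with `δ` if `j = 2`. -/
def Ltilde (n : ℕ) (i j : Fin 2) (m : ℕ) : Module.End ℂ (V n) where
  toFun ζ := fun t => ∑ s, Lcoeff i j m t s * shiftFor n j (ζ s)
  map_add' ζ η := by
    funext t
    simp [mul_add, Finset.sum_add_distrib]
  map_smul' c ζ := by
    funext t
    simp [Finset.smul_sum]

/-- The generating series `L̃_{ij}(w, y) = ∑_m L̃_{ij,m}(y) w^{-m}`; the variable of the power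
series ring is `w⁻¹`. -/
def LtildeSeries (n : ℕ) (i j : Fin 2) : PowerSeries (Module.End ℂ (V n)) :=
  PowerSeries.mk (Ltilde n i j)

/-- `L̃_{12}(w, y)` -/
def L12 (n : ℕ) : PowerSeries (Module.End ℂ (V n)) := LtildeSeries n 0 1
/-- `L̃_{21}(w, y)` -/
def L21 (n : ℕ) : PowerSeries (Module.End ℂ (V n)) := LtildeSeries n 1 0
/-- `L̃_{22}(w, y)` -/
def L22 (n : ℕ) : PowerSeries (Module.End ℂ (V n)) := LtildeSeries n 1 1

/-- `F̃(w, y) = L̃_{12} ∘ L̃_{22}⁻¹` (`Ring.inverse` is the two-sided inverse of a unit). -/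
def Ftilde (n : ℕ) : PowerSeries (Module.End ℂ (V n)) := L12 n * Ring.inverse (L22 n)

/-- `Ẽ(w, y) = L̃_{22}⁻¹ ∘ L̃_{21}` -/
def Etilde (n : ℕ) : PowerSeries (Module.End ℂ (V n)) := Ring.inverse (L22 n) * L21 n

/-- The result `A(w) ζ = ∑_m A_m ζ w^{-m}` of applying a generating series of operators to a
vector, in coordinates. -/
def applySeries {n : ℕ} (A : PowerSeries (Module.End ℂ (V n))) (ζ : V n) : Conf n → WSeries n :=
  fun t => HahnSeries.ofPowerSeries ℤ (RatFun n)
    (PowerSeries.mk fun m => ((PowerSeries.coeff m A ζ t : coeffAlg n) : RatFun n))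

/-- A vector of `V(z_1) ⊗ ⋯ ⊗ V(z_n)`, as a constant series in `w⁻¹`. -/
def constVec {n : ℕ} (ζ : V n) : Conf n → WSeries n := fun t => cS ((ζ t : coeffAlg n) : RatFun n)

/-! ### Weight functions and the vectors `ξ_I` -/

section Weight

variable {𝔽 : Type*} [Field 𝔽] {n k : ℕ}

/-- `w(i, I)` -/
def wIdx (i : Fin n) (I : Finset (Fin n)) : ℤ :=
  -(((Finset.univ.filter fun j => i < j ∧ j ∉ I).card : ℕ) : ℤ) +
    (((Finset.univ.filter fun j => i < j ∧ j ∈ I).card : ℕ) : ℤ)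

/-- `l_I(r, a)`, where `i = i_r` and `t = t_r`. -/
def lFac (I : Finset (Fin n)) (lam t : 𝔽) (z : Fin n → 𝔽) (y : 𝔽) (i a : Fin n) : 𝔽 :=
  if a < i then t - z a + y
  else if a = i then lam + t - z a - (wIdx i I : 𝔽) * y
  else t - z a

/-- The weight function `W_I(λ, t, z, y)`, for `I` with `k` elements `i_1 < ⋯ < i_k`. -/
def weightW (I : Finset (Fin n)) (hI : I.card = k) (lam : 𝔽) (t : Fin k → 𝔽)
    (z : Fin n → 𝔽) (y : 𝔽) : 𝔽 :=
  y ^ k * ∑ τ : Equiv.Perm (Fin k),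
    (∏ r : Fin k, ∏ a : Fin n, lFac I lam (t (τ r)) z y (I.orderEmbOfFin hI r) a) *
      ∏ a : Fin k, ∏ b ∈ Finset.Ioi a, (t (τ a) - t (τ b) + y) / (t (τ a) - t (τ b))

/-- `W_{σ,I}(λ, t, z, y) = W_{σ⁻¹(I)}(λ, t, z_{σ(1)}, …, z_{σ(n)}, y)` -/
def weightWσ (σ : Equiv.Perm (Fin n)) (I : Finset (Fin n)) (hI : I.card = k) (lam : 𝔽)
    (t : Fin k → 𝔽) (z : Fin n → 𝔽) (y : 𝔽) : 𝔽 :=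
  weightW (I.map σ.symm.toEmbedding) ((Finset.card_map _).trans hI) lam t (fun a => z (σ a)) y

/-- `e_k(t, y)` -/
def eFac (t : Fin k → 𝔽) (y : 𝔽) : 𝔽 := ∏ a, ∏ b, (t a - t b + y)

/-- `W̃⁻_K(λ, t, z, y)`; `Fin.revPerm` is the longest permutation. -/
def weightMinus (K : Finset (Fin n)) (hK : K.card = k) (lam : 𝔽) (t : Fin k → 𝔽)
    (z : Fin n → 𝔽) (y : 𝔽) : 𝔽 :=
  (-1) ^ k / eFac t y * weightWσ Fin.revPerm K hK (-lam - ((n : 𝔽) - 2 * (k : 𝔽)) * y) t z y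

/-- `Q_I(z, y)` -/
def QFac (I : Finset (Fin n)) (z : Fin n → 𝔽) (y : 𝔽) : 𝔽 :=
  ∏ a ∈ I, ∏ b ∈ Iᶜ, (z a - z b + y)

end Weight

/-- `z_I = (z_{i_1}, …, z_{i_k})` -/
def zSub {n : ℕ} (I : Finset (Fin n)) : Fin I.card → RatFun n :=
  fun r => zK (I.orderEmbOfFin rfl r)

/-- The coefficient `W̃⁻_J(λ, z_I, z, y) / Q_I(z, y)` of `v_J` in `ξ_I`, for `|J| = |I|`. -/
def xiCoeffK {n : ℕ} (I J : Finset (Fin n)) (h : J.card = I.card) : RatFun n :=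
  1 / QFac I zK (yK n) * weightMinus J h (lamK n) (zSub I) zK (yK n)

theorem xiCoeffK_mem {n : ℕ} (I J : Finset (Fin n)) (h : J.card = I.card) :
    xiCoeffK I J h ∈ coeffAlg n := by
  have hy := yK_zy n
  have hz : ∀ i : Fin n, zK i ∈ zyField n := zK_zy
  have ht : ∀ r, zSub I r ∈ zyField n := fun r => zK_zy _
  have hlam := lam_mem n
  have hint : ∀ m : ℤ, (m : RatFun n) ∈ coeffAlg n := fun m => Subalgebra.intCast_mem _ m
  refine mul_mem (zy_mem ?_) (mul_mem (zy_mem ?_) (mul_mem (zy_mem (pow_mem hy _))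
    (sum_mem fun τ _ => mul_mem (prod_mem fun r _ => prod_mem fun a _ => ?_)
      (zy_mem ?_))))
  · exact div_mem (one_mem _) (prod_mem fun a _ => prod_mem fun b _ =>
      add_mem (sub_mem (hz a) (hz b)) hy)
  · exact div_mem (pow_mem (neg_mem (one_mem _)) _) (prod_mem fun a _ => prod_mem fun b _ =>
      add_mem (sub_mem (ht a) (ht b)) hy)
  · unfold lFac
    split_ifs
    · exact zy_mem (add_mem (sub_mem (ht _) (hz _)) hy)
    · have hn : (n : RatFun n) - 2 * ((I.card : ℕ) : RatFun n) ∈ coeffAlg n := by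
        have := hint ((n : ℤ) - 2 * (I.card : ℤ))
        push_cast at this
        exact this
      exact Subalgebra.sub_mem _ (Subalgebra.sub_mem _ (Subalgebra.add_mem _
        (Subalgebra.sub_mem _ (Subalgebra.neg_mem _ hlam)
          (mul_mem hn (zy_mem hy))) (zy_mem (ht _))) (zy_mem (hz _)))
        (mul_mem (hint _) (zy_mem hy))
    · exact zy_mem (sub_mem (ht _) (hz _))
  · exact prod_mem fun a _ => prod_mem fun b _ =>
      div_mem (add_mem (sub_mem (ht _) (ht _)) hy) (sub_mem (ht _) (ht _))

/-- The label of the basis vector `v_J`: the factor with number `j` is `v_1` if `j ∈ J` and `v_2`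
otherwise. -/
def confOf {n : ℕ} (J : Finset (Fin n)) : Conf n := fun j => if j ∈ J then 0 else 1

/-- The basis vector `v_J`. -/
def vBasis {n : ℕ} (J : Finset (Fin n)) : V n := Pi.single (confOf J) 1

/-- The vector `ξ_I = Q_I(z, y)⁻¹ ∑_{|J| = |I|} W̃⁻_J(λ, z_I, z, y) v_J`. -/
def xi {n : ℕ} (I : Finset (Fin n)) : V n :=
  ∑ J : Finset (Fin n),
    if h : J.card = I.card then
      (⟨xiCoeffK I J h, xiCoeffK_mem I J h⟩ : coeffAlg n) • vBasis J
    else 0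

end DynGL2

end

/-! Everything rests on two identities for the full matrix L(λ, w) acting on ℂ² ⊗ (ℂ²)^{⊗n}. Let f_I
be the claimed value of F̃ ξ_I, and e_I the claimed value of Ẽ ξ_I with λ replaced by λ + y. For
every I, L (v_2 ⊗ ξ_I(λ + y)) = a_I (v_1 ⊗ f_I + v_2 ⊗ ξ_I), L (v_1 ⊗ ξ_I(λ - y) - v_2 ⊗ e_I) = d_I
v_1 ⊗ ξ_I, with explicit scalars a_I, d_I (`Lop_xi`, `Lop_eta`). The first says L̃_{22} ξ_I = a_I
ξ_I and L̃_{12} ξ_I = a_I f_I, hence F̃ ξ_I = f_I. The v_2-component of the second says L_{21} ξ_I(λ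
- y) = L_{22} e_I, and cancelling L_{22} gives Ẽ ξ_I.

Both identities are proved by induction on n, over any field with generic parameters. Since L =
R^{(0,1)} · (L for the remaining points) and R conserves weight, each component in the first tensor
factor reduces to the same identities for n points (`Lop_succ`). The input is a recursion for ξ_I in
the first tensor factor (`xiRec`). For f_I the remaining scalar identities are elementary, after
symmetrizing over the order in which two points are removed. For e_I one sum over all points is
left, and it is evaluated by partial fractions (`sum_resid_mul`, `kappa_mul_aEig`).

That the vectors defined by weight functions obey the recursion is `eqProd_mul_xiRec`: at t = z_I
the symmetrization splits according to which variable goes with the first point, and the factors t_r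
- z_1 kill the unwanted terms. Invertibility of L̃_{22} holds because L_{22} is block triangular in
the first tensor factor, so its determinant is a product of units of ℒ[[w⁻¹]]. -/

noncomputable section
namespace DynGL2

/-! ### Subsets of `Fin (n + 1)` -/

/-- The image of a subset of `Fin n` under `Fin.succ`. -/
def upF {n : ℕ} (I : Finset (Fin n)) : Finset (Fin (n + 1)) := I.map (Fin.succEmb n)

/-- The preimage of a subset of `Fin (n + 1)` under `Fin.succ`. -/
def downF {n : ℕ} (I : Finset (Fin (n + 1))) : Finset (Fin n) :=
  Finset.univ.filter fun i => i.succ ∈ I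

section Subsets

variable {n : ℕ}

@[simp] theorem succ_mem_upF (I : Finset (Fin n)) (i : Fin n) : i.succ ∈ upF I ↔ i ∈ I := by
  simp [upF]

@[simp] theorem zero_notMem_upF (I : Finset (Fin n)) : (0 : Fin (n + 1)) ∉ upF I := by
  simp [upF]

@[simp] theorem card_upF (I : Finset (Fin n)) : (upF I).card = I.card := by simp [upF]

@[simp] theorem card_insert_upF (I : Finset (Fin n)) :
    (insert 0 (upF I)).card = I.card + 1 := by
  rw [Finset.card_insert_of_notMem (zero_notMem_upF I), card_upF]

@[simp] theorem downF_upF (I : Finset (Fin n)) : downF (upF I) = I := by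
  ext i; simp [downF]

@[simp] theorem downF_insert_upF (I : Finset (Fin n)) : downF (insert 0 (upF I)) = I := by
  ext i; simp [downF, Fin.succ_ne_zero]

theorem upF_downF {I : Finset (Fin (n + 1))} (h : 0 ∉ I) : upF (downF I) = I := by
  ext i
  induction i using Fin.cases with
  | zero => simp [h]
  | succ i => simp [downF]

theorem insert_upF_downF {I : Finset (Fin (n + 1))} (h : 0 ∈ I) :
    insert 0 (upF (downF I)) = I := by
  ext i
  induction i using Fin.cases with
  | zero => simp [h]
  | succ i => simp [downF, Fin.succ_ne_zero]

@[elab_as_elim]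
theorem finset_fin_succ_cases {P : Finset (Fin (n + 1)) → Prop} (I : Finset (Fin (n + 1)))
    (h0 : ∀ I', P (insert 0 (upF I'))) (h1 : ∀ I', P (upF I')) : P I := by
  by_cases h : 0 ∈ I
  · rw [← insert_upF_downF h]; exact h0 _
  · rw [← upF_downF h]; exact h1 _

@[simp] theorem upF_erase_succ (I : Finset (Fin n)) (i : Fin n) :
    (upF I).erase i.succ = upF (I.erase i) := by
  ext j
  induction j using Fin.cases <;> simp

@[simp] theorem insert_upF_erase_succ (I : Finset (Fin n)) (i : Fin n) :
    (insert 0 (upF I)).erase i.succ = insert 0 (upF (I.erase i)) := by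
  ext j
  induction j using Fin.cases <;> simp [(Fin.succ_ne_zero _).symm]

@[simp] theorem insert_upF_erase_zero (I : Finset (Fin n)) :
    (insert 0 (upF I)).erase 0 = upF I := Finset.erase_insert (zero_notMem_upF I)

@[simp] theorem upF_insert_succ (I : Finset (Fin n)) (i : Fin n) :
    insert i.succ (upF I) = upF (insert i I) := by
  ext j
  induction j using Fin.cases <;> simp [(Fin.succ_ne_zero _).symm]

@[simp] theorem insert_upF_insert_succ (I : Finset (Fin n)) (i : Fin n) :
    insert i.succ (insert 0 (upF I)) = insert 0 (upF (insert i I)) := by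
  rw [Finset.insert_comm, upF_insert_succ]

@[simp] theorem compl_upF (I : Finset (Fin n)) : (upF I)ᶜ = insert 0 (upF Iᶜ) := by
  ext j
  induction j using Fin.cases <;> simp

@[simp] theorem compl_insert_upF (I : Finset (Fin n)) : (insert 0 (upF I))ᶜ = upF Iᶜ := by
  ext j
  induction j using Fin.cases <;> simp

variable {M : Type*}

@[simp] theorem prod_upF [CommMonoid M] (I : Finset (Fin n)) (f : Fin (n + 1) → M) :
    ∏ i ∈ upF I, f i = ∏ i ∈ I, f i.succ := by simp [upF]

@[simp] theorem prod_insert_upF [CommMonoid M] (I : Finset (Fin n)) (f : Fin (n + 1) → M) :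
    ∏ i ∈ insert 0 (upF I), f i = f 0 * ∏ i ∈ I, f i.succ := by
  rw [Finset.prod_insert (zero_notMem_upF I), prod_upF]

@[simp] theorem sum_upF [AddCommMonoid M] (I : Finset (Fin n)) (f : Fin (n + 1) → M) :
    ∑ i ∈ upF I, f i = ∑ i ∈ I, f i.succ := by simp [upF]

@[simp] theorem sum_insert_upF [AddCommMonoid M] (I : Finset (Fin n)) (f : Fin (n + 1) → M) :
    ∑ i ∈ insert 0 (upF I), f i = f 0 + ∑ i ∈ I, f i.succ := by
  rw [Finset.sum_insert (zero_notMem_upF I), sum_upF]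

theorem sum_conf_succ [AddCommMonoid M] (f : Conf (n + 1) → M) :
    ∑ s, f s = ∑ b : Fin 2, ∑ t : Conf n, f (Fin.cons b t) := by
  rw [← Fintype.sum_prod_type']
  exact (Fintype.sum_equiv (Fin.consEquiv fun _ : Fin (n + 1) => Fin 2) _ _ fun _ => rfl).symm

/-- The vector `v_1 ⊗ A + v_2 ⊗ B`. -/
def vcons (A B : Conf n → M) : Conf (n + 1) → M := fun s =>
  if s 0 = 0 then A (Fin.tail s) else B (Fin.tail s)

@[simp] theorem vcons_cons_zero (A B : Conf n → M) (s : Conf n) :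
    vcons A B (Fin.cons 0 s) = A s := by simp [vcons]

@[simp] theorem vcons_cons_one (A B : Conf n → M) (s : Conf n) :
    vcons A B (Fin.cons 1 s) = B s := by simp [vcons]

end Subsets

section Generic

variable {𝔽 : Type*} [Field 𝔽] {n : ℕ}

/-! ### The L-operator and the first tensor factor -/

theorem exists_eq_cons (s : Conf (n + 1)) : ∃ (b : Fin 2) (t : Conf n), s = Fin.cons b t :=
  ⟨s 0, Fin.tail s, (Fin.cons_self_tail s).symm⟩

/-- A matrix on `ℂ² ⊗ (ℂ²)^{⊗ n}`, acting in the auxiliary factor and in the last `n` factors of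
`ℂ² ⊗ (ℂ²)^{⊗ (n + 1)}`. -/
def liftFun (A : Matrix (Fin 2 × Conf n) (Fin 2 × Conf n) 𝔽) :
    Matrix (Fin 2 × Conf (n + 1)) (Fin 2 × Conf (n + 1)) 𝔽 :=
  Matrix.of fun p q => if p.2 0 = q.2 0 then A (p.1, Fin.tail p.2) (q.1, Fin.tail q.2) else 0

theorem liftFun_cons (A : Matrix (Fin 2 × Conf n) (Fin 2 × Conf n) 𝔽) (c d a b : Fin 2)
    (s t : Conf n) : liftFun A (c, Fin.cons a s) (d, Fin.cons b t) =
      if a = b then A (c, s) (d, t) else 0 := by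
  simp [liftFun]

/-- `liftFun`, as a homomorphism of monoids. -/
def liftMat : Matrix (Fin 2 × Conf n) (Fin 2 × Conf n) 𝔽 →*
    Matrix (Fin 2 × Conf (n + 1)) (Fin 2 × Conf (n + 1)) 𝔽 where
  toFun := liftFun
  map_one' := by
    ext ⟨c, s⟩ ⟨d, t⟩
    obtain ⟨a, s, rfl⟩ := exists_eq_cons s
    obtain ⟨b, t, rfl⟩ := exists_eq_cons t
    simp only [liftFun_cons, Matrix.one_apply, Prod.mk.injEq, Fin.cons_inj]
    split_ifs <;> simp_all
  map_mul' A B := by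
    ext ⟨c, s⟩ ⟨d, t⟩
    obtain ⟨a, s, rfl⟩ := exists_eq_cons s
    obtain ⟨b, t, rfl⟩ := exists_eq_cons t
    simp only [Matrix.mul_apply, Fintype.sum_prod_type, sum_conf_succ, liftFun_cons]
    by_cases h : a = b
    · rw [if_pos h]
      refine Finset.sum_congr rfl fun e _ => ?_
      rw [Finset.sum_eq_single b]
      · simp [h]
      · intro e _ hb
        simp [hb]
      · simp
    · rw [if_neg h]
      refine (Finset.sum_eq_zero fun e _ => Finset.sum_eq_zero fun f _ =>
        Finset.sum_eq_zero fun u _ => ?_).symm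
      by_cases h1 : a = f
      · have : f ≠ b := fun h2 => h (h1.trans h2)
        simp [this]
      · simp [h1]

@[simp] theorem liftMat_cons (A : Matrix (Fin 2 × Conf n) (Fin 2 × Conf n) 𝔽) (c d a b : Fin 2)
    (s t : Conf n) : liftMat A (c, Fin.cons a s) (d, Fin.cons b t) =
      if a = b then A (c, s) (d, t) else 0 := liftFun_cons A c d a b s t

/-- The dynamical shift of R^{(0,j)} only involves factors to the right of j, so the first tensor
factor is a spectator. This is why the induction removes the first point and not the last. -/
theorem R0_succ (lam y x : 𝔽) (j : Fin n) : R0 lam y x j.succ = liftMat (R0 lam y x j) := by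
  ext ⟨c, s⟩ ⟨d, t⟩
  change R0 lam y x j.succ (c, s) (d, t) =
    if s 0 = t 0 then R0 lam y x j (c, Fin.tail s) (d, Fin.tail t) else 0
  simp only [R0, Fin.forall_fin_succ, Fin.tail]
  have hs : ∑ m ∈ Finset.Ioi j.succ, wt (t m) = ∑ m ∈ Finset.Ioi j, wt (t m.succ) := by
    rw [← Fin.map_succEmb_Ioi, Finset.sum_map]; rfl
  rw [hs]
  by_cases h : s 0 = t 0
  · simp [h]
  · simp [h, (Fin.succ_ne_zero j).symm]

/-- The weight of a basis vector of `(ℂ²)^{⊗ n}`. -/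
def wtSum (s : Conf n) : ℤ := ∑ m, wt (s m)

theorem wtSum_cons (b : Fin 2) (s : Conf n) :
    wtSum (Fin.cons b s : Conf (n + 1)) = wt b + wtSum s := by
  simp [wtSum, Fin.sum_univ_succ]

/-- The leftmost factor R^{(0,1)} leaves the later tensor factors alone, so its shift can be read
off from the output label `s`. -/
theorem Lmat_succ (lam w y : 𝔽) (z : Fin (n + 1) → 𝔽) (c d a b : Fin 2) (s t : Conf n) :
    Lmat lam w y z (c, Fin.cons a s) (d, Fin.cons b t) =
      ∑ e, Rmat (lam - y * (wtSum s : 𝔽)) (w - z 0) y (c, a) (e, b) *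
        Lmat lam w y (Fin.tail z) (e, s) (d, t) := by
  have h : Lmat lam w y z = R0 lam y (w - z 0) 0 * liftMat (Lmat lam w y (Fin.tail z)) := by
    rw [Lmat, Lmat, List.ofFn_succ, List.prod_cons, map_list_prod, List.map_ofFn]
    congr 2
    exact congrArg _ (funext fun j => R0_succ _ _ _ _)
  rw [h, Matrix.mul_apply, Fintype.sum_prod_type]
  refine Finset.sum_congr rfl fun e _ => ?_
  rw [sum_conf_succ, Finset.sum_eq_single b, Finset.sum_eq_single s]
  · have hs : ∑ m ∈ Finset.Ioi (0 : Fin (n + 1)), wt ((Fin.cons b s : Conf (n + 1)) m) =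
        wtSum s := by
      rw [Fin.Ioi_zero_eq_map, Finset.sum_map]; simp [wtSum]
    have hc : ∀ m : Fin (n + 1), m ≠ 0 →
        (Fin.cons a s : Conf (n + 1)) m = (Fin.cons b s : Conf (n + 1)) m := by
      intro m hm
      obtain ⟨m, rfl⟩ := Fin.exists_succ_eq.2 hm
      simp
    simp only [R0]
    rw [if_pos hc, hs]
    simp
  · intro u _ hu
    have : ¬ ∀ m : Fin (n + 1), m ≠ 0 →
        (Fin.cons a s : Conf (n + 1)) m = (Fin.cons b u : Conf (n + 1)) m := by
      intro hm
      exact hu (funext fun m => by simpa using (hm m.succ (Fin.succ_ne_zero m)).symm)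
    simp [R0, this]
  · simp
  · intro e' _ he
    refine Finset.sum_eq_zero fun u _ => ?_
    simp [he]
  · simp

theorem Lmat_zero (lam w y : 𝔽) (z : Fin 0 → 𝔽) : Lmat lam w y z = 1 := by
  simp [Lmat]

/-- The action of the L-operator on `𝔽² ⊗ (𝔽²)^{⊗ n}`. -/
def Lop (lam w y : 𝔽) (z : Fin n → 𝔽) :
    (Fin 2 → Conf n → 𝔽) →ₗ[𝔽] (Fin 2 → Conf n → 𝔽) where
  toFun u c s := ∑ d, ∑ t, Lmat lam w y z (c, s) (d, t) * u d t
  map_add' u v := by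
    funext c s
    simp [mul_add, Finset.sum_add_distrib]
  map_smul' r u := by
    funext c s
    simp only [Pi.smul_apply, smul_eq_mul, RingHom.id_apply, Finset.mul_sum]
    exact Finset.sum_congr rfl fun _ _ => Finset.sum_congr rfl fun _ _ => by ring

theorem Lop_zero (lam w y : 𝔽) (z : Fin 0 → 𝔽) (u : Fin 2 → Conf 0 → 𝔽) :
    Lop lam w y z u = u := by
  funext c s
  change ∑ d, ∑ t, Lmat lam w y z (c, s) (d, t) * u d t = _
  rw [Lmat_zero, ← Fintype.sum_prod_type' (f := fun d t =>
    (1 : Matrix (Fin 2 × Conf 0) (Fin 2 × Conf 0) 𝔽) (c, s) (d, t) * u d t),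
    Finset.sum_eq_single (c, s)]
  · simp
  · intro p _ hp
    rw [Matrix.one_apply_ne (Ne.symm hp), zero_mul]
  · simp

theorem Lop_succ (lam w y : 𝔽) (z : Fin (n + 1) → 𝔽) (u : Fin 2 → Conf (n + 1) → 𝔽)
    (c a : Fin 2) (s : Conf n) :
    Lop lam w y z u c (Fin.cons a s) =
      ∑ e, ∑ b, Rmat (lam - y * (wtSum s : 𝔽)) (w - z 0) y (c, a) (e, b) *
        Lop lam w y (Fin.tail z) (fun d t => u d (Fin.cons b t)) e s := by
  change ∑ d, ∑ t, Lmat lam w y z (c, Fin.cons a s) (d, t) * u d t = ∑ e, ∑ b, _ *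
    ∑ d, ∑ t, Lmat lam w y (Fin.tail z) (e, s) (d, t) * u d (Fin.cons b t)
  simp only [sum_conf_succ, Lmat_succ, Finset.sum_mul, Finset.mul_sum]
  simp only [Fin.sum_univ_two, ← Finset.sum_add_distrib]
  exact Finset.sum_congr rfl fun _ _ => by ring

/-! ### The vectors `ξ_I`, recursively -/

/-- `(a - b + y) / (a - b)` -/
def gFac (y a b : 𝔽) : 𝔽 := (a - b + y) / (a - b)

/-- `∏_{q ∈ I} (z_q - x) / (z_q - x + y)` -/
def hProd (y x : 𝔽) (z : Fin n → 𝔽) (I : Finset (Fin n)) : 𝔽 :=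
  ∏ q ∈ I, (z q - x) / (z q - x + y)

/-- The coefficient of `v_1 ⊗ ξ_{I - {p}}` in the vector `ξ_I` for the points `x, z_1, …, z_n`. -/
def cCo (lam y x : 𝔽) (z : Fin n → 𝔽) (I : Finset (Fin n)) (p : Fin n) : 𝔽 :=
  y * (lam + ((n : 𝔽) + 1 - 2 * (I.card : 𝔽)) * y - z p + x) / (z p - x + y) *
    (hProd y x z (I.erase p) * ∏ q ∈ I.erase p, gFac y (z q) (z p))

/-- The vectors `ξ_I`, defined by recursion on the number of tensor factors. -/
def xiRec (lam y : 𝔽) : ∀ {n : ℕ}, (Fin n → 𝔽) → Finset (Fin n) → Conf n → 𝔽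
  | 0, _, _ => 1
  | n + 1, z, I =>
    if 0 ∈ I then
      vcons ((lam + ((n : 𝔽) + 1 - 2 * (I.card : 𝔽)) * y) •
        xiRec lam y (Fin.tail z) (downF I)) 0
    else
      vcons (∑ p ∈ downF I, cCo lam y (z 0) (Fin.tail z) (downF I) p •
          xiRec lam y (Fin.tail z) ((downF I).erase p))
        (hProd y (z 0) (Fin.tail z) (downF I) • xiRec lam y (Fin.tail z) (downF I))

theorem xiRec_insert (lam y : 𝔽) (z : Fin (n + 1) → 𝔽) (I : Finset (Fin n)) :
    xiRec lam y z (insert 0 (upF I)) =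
      vcons ((lam + ((n : 𝔽) - 1 - 2 * (I.card : 𝔽)) * y) • xiRec lam y (Fin.tail z) I) 0 := by
  rw [xiRec, if_pos (Finset.mem_insert_self _ _), card_insert_upF, downF_insert_upF]
  congr 3
  push_cast; ring

theorem xiRec_up (lam y : 𝔽) (z : Fin (n + 1) → 𝔽) (I : Finset (Fin n)) :
    xiRec lam y z (upF I) =
      vcons (∑ p ∈ I, cCo lam y (z 0) (Fin.tail z) I p • xiRec lam y (Fin.tail z) (I.erase p))
        (hProd y (z 0) (Fin.tail z) I • xiRec lam y (Fin.tail z) I) := by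
  rw [xiRec, if_neg (zero_notMem_upF I), downF_upF]

/-- ξ_I is a weight vector. In the inductions this turns the label-dependent parameter λ - y h of R
into the number λ - y (2|I| - n). -/
theorem xiRec_eq_zero (lam y : 𝔽) (z : Fin n → 𝔽) (I : Finset (Fin n)) (s : Conf n)
    (h : wtSum s ≠ 2 * I.card - n) : xiRec lam y z I s = 0 := by
  induction n with
  | zero =>
    exfalso; apply h
    rw [Finset.eq_empty_of_isEmpty I]; simp [wtSum]
  | succ n ih =>
    obtain ⟨b, s, rfl⟩ := exists_eq_cons s
    rw [wtSum_cons] at h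
    induction I using finset_fin_succ_cases with
    | h0 I =>
      rw [card_insert_upF] at h
      rw [xiRec_insert]
      fin_cases b
      · have h' : wtSum s ≠ 2 * I.card - n := by
          intro h'; apply h; rw [h']; simp [wt]; ring
        simp [ih _ _ _ h']
      · simp
    | h1 I =>
      rw [card_upF] at h
      rw [xiRec_up]
      fin_cases b
      · simp only [Fin.zero_eta, vcons_cons_zero, Finset.sum_apply, Pi.smul_apply, smul_eq_mul]
        refine Finset.sum_eq_zero fun p hp => ?_
        rw [ih, mul_zero]
        intro h'; apply h
        have := Finset.card_erase_add_one hp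
        rw [h', ← this]; simp [wt]; ring
      · have h' : wtSum s ≠ 2 * I.card - n := by
          intro h'; apply h; rw [h']; simp [wt]; ring
        simp [ih _ _ _ h']

end Generic

section Generic

variable {𝔽 : Type*} [Field 𝔽] {n : ℕ}

/-! ### Generic parameters -/

/-- Parameters for which all denominators below are nonzero. -/
structure Generic (lam w y : 𝔽) (z : Fin n → 𝔽) : Prop where
  y_ne : y ≠ 0
  lam_ne : ∀ l : ℤ, lam + l * y ≠ 0
  w_ne : ∀ i, w - z i ≠ 0
  wy_ne : ∀ i, w - z i - y ≠ 0
  z_ne : ∀ i j, i ≠ j → z i - z j ≠ 0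
  zy_ne : ∀ i j, z i - z j + y ≠ 0

theorem Generic.tail {lam w y : 𝔽} {z : Fin (n + 1) → 𝔽} (h : Generic lam w y z) :
    Generic lam w y (Fin.tail z) where
  y_ne := h.y_ne
  lam_ne := h.lam_ne
  w_ne i := h.w_ne i.succ
  wy_ne i := h.wy_ne i.succ
  z_ne i j hij := h.z_ne _ _ (by simpa using hij)
  zy_ne i j := h.zy_ne _ _

theorem Generic.weight_ne {lam w y : 𝔽} {z : Fin n → 𝔽} (h : Generic lam w y z) (l : ℤ) :
    lam - y * (l : 𝔽) ≠ 0 := by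
  have := h.lam_ne (-l)
  intro h0; apply this; rw [← h0]; push_cast; ring

/-! ### Entries of the action of the L-operator -/

section Entries

variable (lam w y : 𝔽) (z : Fin (n + 1) → 𝔽) (A B C D : Conf n → 𝔽) (s : Conf n)

/-- R conserves the total weight of its two factors. Outputs v_1 ⊗ v_1 and v_2 ⊗ v_2 therefore come
with coefficient 1 from the same input, and only the two mixed outputs below involve R nontrivially.
-/
theorem Lop_zero_zero : Lop lam w y z ![vcons A B, vcons C D] 0 (Fin.cons 0 s) =
    Lop lam w y (Fin.tail z) ![A, C] 0 s := by
  have h : (fun (d : Fin 2) (t : Conf n) =>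
      (![vcons A B, vcons C D] : Fin 2 → Conf (n + 1) → 𝔽) d (Fin.cons 0 t)) = ![A, C] := by
    funext d t; fin_cases d <;> simp
  rw [Lop_succ]; simp only [Fin.sum_univ_two, h]; simp [Rmat]

theorem Lop_one_one : Lop lam w y z ![vcons A B, vcons C D] 1 (Fin.cons 1 s) =
    Lop lam w y (Fin.tail z) ![B, D] 1 s := by
  have h : (fun (d : Fin 2) (t : Conf n) =>
      (![vcons A B, vcons C D] : Fin 2 → Conf (n + 1) → 𝔽) d (Fin.cons 1 t)) = ![B, D] := by
    funext d t; fin_cases d <;> simp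
  rw [Lop_succ]; simp only [Fin.sum_univ_two, h]; simp [Rmat]

theorem Lop_zero_one : Lop lam w y z ![vcons A B, vcons C D] 0 (Fin.cons 1 s) =
    Rmat (lam - y * (wtSum s : 𝔽)) (w - z 0) y (0, 1) (0, 1) *
      Lop lam w y (Fin.tail z) ![B, D] 0 s +
    Rmat (lam - y * (wtSum s : 𝔽)) (w - z 0) y (0, 1) (1, 0) *
      Lop lam w y (Fin.tail z) ![A, C] 1 s := by
  have h : (fun (d : Fin 2) (t : Conf n) =>
      (![vcons A B, vcons C D] : Fin 2 → Conf (n + 1) → 𝔽) d (Fin.cons 1 t)) = ![B, D] := by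
    funext d t; fin_cases d <;> simp
  have h' : (fun (d : Fin 2) (t : Conf n) =>
      (![vcons A B, vcons C D] : Fin 2 → Conf (n + 1) → 𝔽) d (Fin.cons 0 t)) = ![A, C] := by
    funext d t; fin_cases d <;> simp
  rw [Lop_succ]; simp only [Fin.sum_univ_two, h, h']; simp [Rmat]

theorem Lop_one_zero : Lop lam w y z ![vcons A B, vcons C D] 1 (Fin.cons 0 s) =
    Rmat (lam - y * (wtSum s : 𝔽)) (w - z 0) y (1, 0) (0, 1) *
      Lop lam w y (Fin.tail z) ![B, D] 0 s +
    Rmat (lam - y * (wtSum s : 𝔽)) (w - z 0) y (1, 0) (1, 0) *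
      Lop lam w y (Fin.tail z) ![A, C] 1 s := by
  have h : (fun (d : Fin 2) (t : Conf n) =>
      (![vcons A B, vcons C D] : Fin 2 → Conf (n + 1) → 𝔽) d (Fin.cons 1 t)) = ![B, D] := by
    funext d t; fin_cases d <;> simp
  have h' : (fun (d : Fin 2) (t : Conf n) =>
      (![vcons A B, vcons C D] : Fin 2 → Conf (n + 1) → 𝔽) d (Fin.cons 0 t)) = ![A, C] := by
    funext d t; fin_cases d <;> simp
  rw [Lop_succ]; simp only [Fin.sum_univ_two, h, h']; simp [Rmat]

end Entries

theorem vcons_zero_zero : (vcons 0 0 : Conf (n + 1) → 𝔽) = 0 := by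
  funext s; simp [vcons]

theorem vec_zero_zero {X : Type*} : (![0, 0] : Fin 2 → X → 𝔽) = 0 := by
  funext d x; fin_cases d <;> simp

theorem vec_zero_smul {X : Type*} (c : 𝔽) (A : X → 𝔽) :
    (![0, c • A] : Fin 2 → X → 𝔽) = c • ![0, A] := by simp

theorem vec_zero_sum {X ι : Type*} (S : Finset ι) (c : ι → 𝔽) (A : ι → X → 𝔽) :
    (![0, ∑ i ∈ S, c i • A i] : Fin 2 → X → 𝔽) = ∑ i ∈ S, c i • ![0, A i] := by
  funext d x; fin_cases d <;> simp [Finset.sum_apply]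

/-! ### The action of `L_{22}` and `L_{12}` -/

/-- `∏_{s ∈ I - {i}} (z_s - z_i + y) / (z_s - z_i)` -/
def gProd (y : 𝔽) (z : Fin n → 𝔽) (I : Finset (Fin n)) (i : Fin n) : 𝔽 :=
  ∏ s ∈ I.erase i, gFac y (z s) (z i)

/-- The eigenvalue of `L̃_{22}` on `ξ_I`. -/
def aEig (w y : 𝔽) (z : Fin n → 𝔽) (I : Finset (Fin n)) : 𝔽 :=
  ∏ i ∈ I, (w - z i) / (w - z i - y)

/-- The coefficient of `ξ_{I - {i}}` in `F̃ ξ_I`. -/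
def fCo (lam w y : 𝔽) (z : Fin n → 𝔽) (I : Finset (Fin n)) (i : Fin n) : 𝔽 :=
  -y * (lam + w - z i + y * ((n : 𝔽) - 2 * (I.card : 𝔽) + 1)) / (w - z i) * gProd y z I i

/-- The vector `F̃ ξ_I`. -/
def fVec (lam w y : 𝔽) (z : Fin n → 𝔽) (I : Finset (Fin n)) : Conf n → 𝔽 :=
  ∑ i ∈ I, fCo lam w y z I i • xiRec lam y z (I.erase i)

theorem gProd_up (y : 𝔽) (z : Fin (n + 1) → 𝔽) (I : Finset (Fin n)) (i : Fin n) :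
    gProd y z (upF I) i.succ = gProd y (Fin.tail z) I i := by
  simp [gProd, Fin.tail]

theorem gProd_insert (y : 𝔽) (z : Fin (n + 1) → 𝔽) (I : Finset (Fin n)) (i : Fin n) :
    gProd y z (insert 0 (upF I)) i.succ = gFac y (z 0) (z i.succ) * gProd y (Fin.tail z) I i := by
  simp [gProd, Fin.tail]

theorem gProd_insert_zero (y : 𝔽) (z : Fin (n + 1) → 𝔽) (I : Finset (Fin n)) :
    gProd y z (insert 0 (upF I)) 0 = ∏ s ∈ I, gFac y (Fin.tail z s) (z 0) := by
  simp [gProd, Fin.tail]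

theorem aEig_up (w y : 𝔽) (z : Fin (n + 1) → 𝔽) (I : Finset (Fin n)) :
    aEig w y z (upF I) = aEig w y (Fin.tail z) I := by
  simp [aEig, Fin.tail]

theorem aEig_insert (w y : 𝔽) (z : Fin (n + 1) → 𝔽) (I : Finset (Fin n)) :
    aEig w y z (insert 0 (upF I)) =
      (w - z 0) / (w - z 0 - y) * aEig w y (Fin.tail z) I :=
  prod_insert_upF _ _

theorem aEig_erase (w y : 𝔽) (z : Fin n → 𝔽) {I : Finset (Fin n)} {i : Fin n} (h : i ∈ I) :
    aEig w y z I = (w - z i) / (w - z i - y) * aEig w y z (I.erase i) :=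
  (Finset.mul_prod_erase _ _ h).symm

theorem hProd_erase (x y : 𝔽) (z : Fin n → 𝔽) {I : Finset (Fin n)} {i : Fin n} (h : i ∈ I) :
    hProd y x z I = (z i - x) / (z i - x + y) * hProd y x z (I.erase i) :=
  (Finset.mul_prod_erase _ _ h).symm

theorem gProd_erase (y : 𝔽) (z : Fin n → 𝔽) {I : Finset (Fin n)} {i j : Fin n} (h : j ∈ I.erase i) :
    gProd y z I i = gFac y (z j) (z i) * gProd y z (I.erase j) i := by
  rw [gProd, gProd, Finset.erase_right_comm,
    Finset.mul_prod_erase _ (fun s => gFac y (z s) (z i)) h]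

theorem cCo_eq (lam y x : 𝔽) (z : Fin n → 𝔽) (I : Finset (Fin n)) (p : Fin n) :
    cCo lam y x z I p =
      y * (lam + ((n : 𝔽) + 1 - 2 * (I.card : 𝔽)) * y - z p + x) / (z p - x + y) *
        (hProd y x z (I.erase p) * gProd y z I p) := rfl

/-- At x = z_0 the factors of `hProd` and `gFac` are inverse to each other. -/
theorem hProd_mul_gFac {lam w y : 𝔽} {z : Fin (n + 1) → 𝔽} (h : Generic lam w y z)
    (I : Finset (Fin n)) :
    hProd y (z 0) (Fin.tail z) I * ∏ s ∈ I, gFac y (Fin.tail z s) (z 0) = 1 := by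
  rw [hProd, ← Finset.prod_mul_distrib]
  refine Finset.prod_eq_one fun i _ => ?_
  have h1 := h.z_ne i.succ 0 (Fin.succ_ne_zero i)
  have h2 := h.zy_ne i.succ 0
  simp only [Fin.tail, gFac]
  field_simp

theorem cast_card_erase {I : Finset (Fin n)} {i : Fin n} (h : i ∈ I) :
    (I.card : 𝔽) = ((I.erase i).card : 𝔽) + 1 := by
  rw [← Finset.card_erase_add_one h]; push_cast; ring

theorem tail_apply {𝔽 : Type*} {n : ℕ} (z : Fin (n + 1) → 𝔽) (i : Fin n) :
    Fin.tail z i = z i.succ := rfl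

/-- Two double sums agree if their summands agree after symmetrization. -/
theorem sum_sum_erase_eq [NeZero (2 : 𝔽)] {ι : Type*} [DecidableEq ι] (I : Finset ι)
    (X Y : ι → ι → 𝔽) (h : ∀ i ∈ I, ∀ j ∈ I, i ≠ j → X i j + X j i = Y i j + Y j i) :
    ∑ i ∈ I, ∑ j ∈ I.erase i, X i j = ∑ i ∈ I, ∑ j ∈ I.erase i, Y i j := by
  have key : ∀ Z : ι → ι → 𝔽, ∑ i ∈ I, ∑ j ∈ I.erase i, Z i j =
      ∑ i ∈ I, ∑ j ∈ I.erase i, Z j i := fun Z =>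
    Finset.sum_comm' (by intro a b; simp only [Finset.mem_erase]; tauto)
  have h2 : ∀ Z : ι → ι → 𝔽, 2 * ∑ i ∈ I, ∑ j ∈ I.erase i, Z i j =
      ∑ i ∈ I, ∑ j ∈ I.erase i, (Z i j + Z j i) := by
    intro Z
    simp only [Finset.sum_add_distrib, two_mul]
    rw [← key Z]
  apply mul_left_cancel₀ (two_ne_zero (α := 𝔽))
  rw [h2, h2]
  refine Finset.sum_congr rfl fun i hi => Finset.sum_congr rfl fun j hj => ?_
  exact h i hi j (Finset.mem_of_mem_erase hj) (Finset.ne_of_mem_erase hj).symm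

/-- Here ξ is a multiple of v_1 ⊗ ξ_I, so three components follow from `ih` by a scalar identity or
are zero. In the v_1 ⊗ v_1 component two routes lead to ξ_{I - {p}}: remove p directly, or remove 0
and expand the resulting vector by the recursion. -/
theorem Lop_xi_insert {lam w y : 𝔽} {z : Fin (n + 1) → 𝔽} (hg : Generic lam w y z)
    (I : Finset (Fin n))
    (ih : Lop lam w y (Fin.tail z) ![0, xiRec (lam + y) y (Fin.tail z) I] =
      aEig w y (Fin.tail z) I • ![fVec lam w y (Fin.tail z) I, xiRec lam y (Fin.tail z) I]) :
    Lop lam w y z ![0, xiRec (lam + y) y z (insert 0 (upF I))] =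
      aEig w y z (insert 0 (upF I)) •
        ![fVec lam w y z (insert 0 (upF I)), xiRec lam y z (insert 0 (upF I))] := by
  have hx := hg.w_ne 0
  have hxy := hg.wy_ne 0
  have hL := fun s : Conf n => hg.weight_ne (wtSum s)
  have hz : ∀ i : Fin n, z i.succ - z 0 ≠ 0 := fun i => hg.z_ne _ _ (Fin.succ_ne_zero i)
  have hz' : ∀ i : Fin n, z 0 - z i.succ ≠ 0 := fun i => hg.z_ne _ _ (Fin.succ_ne_zero i).symm
  have hzy : ∀ i : Fin n, z i.succ - z 0 + y ≠ 0 := fun i => hg.zy_ne _ _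
  have hw : ∀ i : Fin n, w - z i.succ ≠ 0 := fun i => hg.w_ne _
  have hwt : ∀ s : Conf n, xiRec lam y (Fin.tail z) I s = 0 ∨
      wtSum s = 2 * I.card - n := fun s => by
    by_contra! h; exact h.1 (xiRec_eq_zero _ _ _ _ _ h.2)
  have hP := hProd_mul_gFac hg I
  funext c s
  obtain ⟨b, s, rfl⟩ := exists_eq_cons s
  rw [xiRec_insert, ← vcons_zero_zero]
  simp only [fVec, sum_insert_upF, insert_upF_erase_zero, insert_upF_erase_succ, xiRec_insert,
    xiRec_up, fCo, gProd_insert, gProd_insert_zero, card_insert_upF, aEig_insert]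
  fin_cases c <;> fin_cases b
  · simp only [Fin.zero_eta, Lop_zero_zero, vec_zero_smul, map_smul, ih]
    simp only [fVec, Pi.smul_apply, Matrix.cons_val_zero, Finset.sum_apply, smul_eq_mul,
      Pi.add_apply, vcons_cons_zero, Finset.mul_sum, ← Finset.sum_add_distrib]
    refine Finset.sum_congr rfl fun p hp => ?_
    -- `hP` with the p-th factor of `hProd` moved to the right.
    have hHP : hProd y (z 0) (Fin.tail z) (I.erase p) * ∏ s ∈ I, gFac y (Fin.tail z s) (z 0) =
        (z p.succ - z 0 + y) / (z p.succ - z 0) := by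
      rw [hProd_erase _ _ _ hp, tail_apply] at hP
      have := hz p; have := hzy p
      field_simp at hP ⊢
      linear_combination hP
    push_cast
    rw [fCo, cCo_eq, tail_apply, cast_card_erase hp]
    generalize hProd y (z 0) (Fin.tail z) (I.erase p) = H at *
    generalize ∏ s ∈ I, gFac y (Fin.tail z s) (z 0) = D at *
    generalize gProd y (Fin.tail z) I p = G at *
    generalize aEig w y (Fin.tail z) I = a at *
    generalize xiRec lam y (Fin.tail z) (I.erase p) s = ξ
    generalize ((I.erase p).card : 𝔽) = K
    have h1 := hz p
    have h2 := hz' p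
    have h3 := hzy p
    have h4 := hw p
    rw [gFac]
    generalize z p.succ = t at *
    -- Coefficients of ξ_{I - {p}} without the common factors: the first summand on the right
    -- removes 0 and then p, the second removes p alone.
    have key : (lam + y + ((n : 𝔽) - 1 - 2 * (K + 1)) * y) *
        (-y * (lam + w - t + y * ((n : 𝔽) - 2 * (K + 1) + 1)) / (w - t)) =
        (w - z 0) / (w - z 0 - y) *
          (-y * (lam + w - z 0 + y * ((n : 𝔽) + 1 - 2 * (K + 1 + 1) + 1)) / (w - z 0) *
            (y * (lam + ((n : 𝔽) + 1 - 2 * (K + 1)) * y - t + z 0) / (t - z 0 + y)) *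
              ((t - z 0 + y) / (t - z 0)) +
          (-y * (lam + w - t + y * ((n : 𝔽) + 1 - 2 * (K + 1 + 1) + 1)) / (w - t)) *
            ((z 0 - t + y) / (z 0 - t)) * (lam + ((n : 𝔽) - 1 - 2 * K) * y)) := by
      rw [show z 0 - t = -(t - z 0) by ring]
      field_simp
      ring
    rw [← hHP] at key
    linear_combination a * G * ξ * key
  · simp only [Fin.zero_eta, Fin.mk_one, Lop_zero_one, vec_zero_smul, map_smul, ih, vec_zero_zero,
      map_zero]
    simp [fVec, Rmat]
    -- Either the vector vanishes at `s`, or the weight of `s` is known and the parameter of R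
    -- becomes explicit.
    rcases hwt s with h | h
    · simp [h]
    have hL := hL s
    rw [h] at hL ⊢
    push_cast at hL ⊢
    generalize hProd y (z 0) (Fin.tail z) I = H at *
    generalize ∏ s ∈ I, gFac y (Fin.tail z s) (z 0) = D at *
    have key : -((lam - y * (2 * (I.card : 𝔽) - n) + (w - z 0)) * y /
          ((lam - y * (2 * (I.card : 𝔽) - n)) * (w - z 0 - y)) *
        (lam + y + ((n : 𝔽) - 1 - 2 * (I.card : 𝔽)) * y)) =
        (w - z 0) / (w - z 0 - y) *
          (-(y * (lam + w - z 0 + y * ((n : 𝔽) + 1 - 2 * ((I.card : 𝔽) + 1) + 1))) / (w - z 0)) := by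
      field_simp
      ring
    linear_combination aEig w y (Fin.tail z) I * xiRec lam y (Fin.tail z) I s * (key -
      (w - z 0) / (w - z 0 - y) *
        (-(y * (lam + w - z 0 + y * ((n : 𝔽) + 1 - 2 * ((I.card : 𝔽) + 1) + 1))) / (w - z 0)) * hP)
  · simp only [Fin.zero_eta, Fin.mk_one, Lop_one_zero, vec_zero_smul, map_smul, ih, vec_zero_zero,
      map_zero]
    simp [fVec, Rmat]
    rcases hwt s with h | h
    · simp [h]
    have hL := hL s
    rw [h] at hL ⊢
    push_cast at hL ⊢
    field_simp
    ring
  · simp only [Fin.mk_one, Lop_one_one, vec_zero_zero, map_zero]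
    simp

/-- All components except v_1 ⊗ v_1 agree term by term in the removed point. In that one two points
are removed. -/
theorem Lop_xi_up [NeZero (2 : 𝔽)] {lam w y : 𝔽} {z : Fin (n + 1) → 𝔽} (hg : Generic lam w y z)
    (I : Finset (Fin n))
    (ih : ∀ I, Lop lam w y (Fin.tail z) ![0, xiRec (lam + y) y (Fin.tail z) I] =
      aEig w y (Fin.tail z) I • ![fVec lam w y (Fin.tail z) I, xiRec lam y (Fin.tail z) I]) :
    Lop lam w y z ![0, xiRec (lam + y) y z (upF I)] =
      aEig w y z (upF I) • ![fVec lam w y z (upF I), xiRec lam y z (upF I)] := by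
  have hx := hg.w_ne 0
  have hxy := hg.wy_ne 0
  have hL := fun s : Conf n => hg.weight_ne (wtSum s)
  have hz : ∀ i : Fin n, z i.succ - z 0 ≠ 0 := fun i => hg.z_ne _ _ (Fin.succ_ne_zero i)
  have hzy : ∀ i : Fin n, z i.succ - z 0 + y ≠ 0 := fun i => hg.zy_ne _ _
  have hw : ∀ i : Fin n, w - z i.succ ≠ 0 := fun i => hg.w_ne _
  have hwy : ∀ i : Fin n, w - z i.succ - y ≠ 0 := fun i => hg.wy_ne _
  have hwt : ∀ (s : Conf n) (p : Fin n), xiRec lam y (Fin.tail z) (I.erase p) s = 0 ∨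
      wtSum s = 2 * (I.erase p).card - n := fun s p => by
    by_contra! h; exact h.1 (xiRec_eq_zero _ _ _ _ _ h.2)
  funext c s
  obtain ⟨b, s, rfl⟩ := exists_eq_cons s
  rw [xiRec_up, ← vcons_zero_zero]
  simp only [fVec, sum_upF, upF_erase_succ, xiRec_up, fCo, gProd_up, card_upF, aEig_up]
  fin_cases c <;> fin_cases b
  · simp only [Fin.zero_eta, Lop_zero_zero, vec_zero_sum, map_sum, map_smul, ih]
    simp only [fVec, Pi.smul_apply, Matrix.cons_val_zero, Finset.sum_apply, smul_eq_mul,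
      vcons_cons_zero, Finset.mul_sum]
    -- The two orders of removing i and j lead to the same vector, and only the sum of both orders
    -- agrees on the two sides. Halving it is where 2 ≠ 0 is needed.
    refine sum_sum_erase_eq I _ _ fun i hi j hj hij => ?_
    have hji : j ∈ I.erase i := Finset.mem_erase.2 ⟨hij.symm, hj⟩
    have hij' : i ∈ I.erase j := Finset.mem_erase.2 ⟨hij, hi⟩
    simp only [fCo, cCo_eq]
    rw [aEig_erase _ _ _ hi, aEig_erase _ _ _ hji, aEig_erase _ _ _ hij',
      hProd_erase _ _ _ hji, hProd_erase _ _ _ hij', gProd_erase _ _ hji, gProd_erase _ _ hij',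
      cast_card_erase hi, cast_card_erase hji, cast_card_erase hij',
      Finset.erase_right_comm (a := j) (b := i)]
    simp only [tail_apply, gFac]
    have h1 := hzy i
    have h2 := hzy j
    have h3 := hw i
    have h4 := hw j
    have h5 := hwy i
    have h6 := hwy j
    have h7 : z i.succ - z j.succ ≠ 0 := hg.z_ne _ _ (by simpa using hij)
    rw [show z j.succ - z i.succ = -(z i.succ - z j.succ) by ring]
    generalize hProd y (z 0) (Fin.tail z) ((I.erase i).erase j) = H
    generalize gProd y (Fin.tail z) (I.erase j) i = Gi
    generalize gProd y (Fin.tail z) (I.erase i) j = Gj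
    generalize aEig w y (Fin.tail z) ((I.erase i).erase j) = a
    generalize xiRec lam y (Fin.tail z) ((I.erase i).erase j) s = ξ
    generalize (((I.erase i).erase j).card : 𝔽) = K
    generalize z i.succ = u at *
    generalize z j.succ = v at *
    push_cast
    field_simp
    ring
  · simp only [Fin.zero_eta, Fin.mk_one, Lop_zero_one, vec_zero_smul, vec_zero_sum, map_sum,
      map_smul, ih]
    simp only [fVec, Pi.smul_apply, Matrix.cons_val_zero, Matrix.cons_val_one, Finset.sum_apply,
      smul_eq_mul, vcons_cons_one, Finset.mul_sum, ← Finset.sum_add_distrib, Rmat, ← mul_assoc]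
    refine Finset.sum_congr rfl fun p hp => ?_
    rcases hwt s p with h | h
    · simp [h]
    have hL := hL s
    rw [h] at hL ⊢
    rw [aEig_erase _ _ _ hp, fCo, cCo_eq, hProd_erase _ _ _ hp, cast_card_erase hp]
    simp only [tail_apply]
    have h1 := hzy p
    have h2 := hw p
    have h3 := hwy p
    push_cast at hL ⊢
    field_simp
    ring
  · simp only [Fin.zero_eta, Fin.mk_one, Lop_one_zero, vec_zero_smul, vec_zero_sum, map_sum,
      map_smul, ih]
    simp only [fVec, Pi.smul_apply, Matrix.cons_val_zero, Matrix.cons_val_one, Finset.sum_apply,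
      smul_eq_mul, vcons_cons_zero, Finset.mul_sum, ← Finset.sum_add_distrib, Rmat, ← mul_assoc,
      Matrix.cons_val_fin_one]
    refine Finset.sum_congr rfl fun p hp => ?_
    rcases hwt s p with h | h
    · simp [h]
    have hL := hL s
    rw [h] at hL ⊢
    rw [aEig_erase _ _ _ hp, fCo, cCo_eq, cCo_eq, hProd_erase _ _ _ hp, cast_card_erase hp]
    simp only [tail_apply]
    have h1 := hzy p
    have h2 := hw p
    have h3 := hwy p
    push_cast at hL ⊢
    field_simp
    ring
  · simp only [Fin.mk_one, Lop_one_one, vec_zero_smul, map_smul, ih]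
    simp only [Pi.smul_apply, Matrix.cons_val_one, Matrix.cons_val_fin_one, smul_eq_mul,
      vcons_cons_one]
    ring

/-- Both rows must be proved together, because the mixed entries of R couple the L_{12} and L_{22}
components of the shorter product. -/
theorem Lop_xi [NeZero (2 : 𝔽)] {lam w y : 𝔽} {z : Fin n → 𝔽} (hg : Generic lam w y z)
    (I : Finset (Fin n)) :
    Lop lam w y z ![0, xiRec (lam + y) y z I] =
      aEig w y z I • ![fVec lam w y z I, xiRec lam y z I] := by
  induction n with
  | zero =>
    rw [Lop_zero, Finset.eq_empty_of_isEmpty I]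
    simp [aEig, fVec, xiRec]
  | succ n ih =>
    induction I using finset_fin_succ_cases with
    | h0 I => exact Lop_xi_insert hg I (ih hg.tail I)
    | h1 I => exact Lop_xi_up hg I (ih hg.tail)

end Generic

section Generic

variable {𝔽 : Type*} [Field 𝔽] {n : ℕ}

/-! ### Partial fractions -/

section PartialFractions

variable {ι : Type*} [DecidableEq ι]

/-- The residue at `z_a` of `∏_{b ∈ S} (1 + ε_b / (z_b - t))`, up to sign. -/
def resid (ε z : ι → 𝔽) (S : Finset ι) (a : ι) : 𝔽 :=
  ε a * ∏ b ∈ S.erase a, (1 + ε b / (z b - z a))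

theorem resid_insert_of_mem (ε z : ι → 𝔽) {S : Finset ι} {a c : ι} (hc : c ∉ S) (ha : a ∈ S) :
    resid ε z (insert c S) a = resid ε z S a * (1 + ε c / (z c - z a)) := by
  have hca : c ≠ a := fun h => hc (h ▸ ha)
  rw [resid, resid, Finset.erase_insert_of_ne hca,
    Finset.prod_insert (fun h => hc (Finset.mem_of_mem_erase h))]
  ring

theorem resid_insert_self (ε z : ι → 𝔽) {S : Finset ι} {c : ι} (hc : c ∉ S) :
    resid ε z (insert c S) c = ε c * ∏ b ∈ S, (1 + ε b / (z b - z c)) := by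
  rw [resid, Finset.erase_insert hc]

/-- Partial fractions in t. When c is adjoined, its residue contains the old product at t = z_c,
which the induction hypothesis expands as well; the rest is the splitting of 1 / ((z_a - z_c)(z_a -
t)). -/
theorem prod_one_add_div (ε z : ι → 𝔽) (S : Finset ι) (t : 𝔽)
    (hz : ∀ a ∈ S, ∀ b ∈ S, a ≠ b → z a - z b ≠ 0) (ht : ∀ a ∈ S, z a - t ≠ 0) :
    ∏ a ∈ S, (1 + ε a / (z a - t)) = 1 + ∑ a ∈ S, resid ε z S a / (z a - t) := by
  induction S using Finset.induction_on generalizing t with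
  | empty => simp
  | insert c S hc ih =>
    have hz' : ∀ a ∈ S, ∀ b ∈ S, a ≠ b → z a - z b ≠ 0 := fun a ha b hb =>
      hz a (Finset.mem_insert_of_mem ha) b (Finset.mem_insert_of_mem hb)
    have hac : ∀ a ∈ S, z a - z c ≠ 0 := fun a ha =>
      hz a (Finset.mem_insert_of_mem ha) c (Finset.mem_insert_self _ _) fun h => hc (h ▸ ha)
    have hct := ht c (Finset.mem_insert_self _ _)
    have e : ∑ a ∈ S, resid ε z (insert c S) a / (z a - t) =
        ∑ a ∈ S, resid ε z S a * (1 + ε c / (z c - z a)) / (z a - t) :=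
      Finset.sum_congr rfl fun a ha => by rw [resid_insert_of_mem ε z hc ha]
    rw [Finset.prod_insert hc, Finset.sum_insert hc, resid_insert_self _ _ hc, e,
      ih t hz' fun a ha => ht a (Finset.mem_insert_of_mem ha), ih (z c) hz' hac]
    have key : ∑ a ∈ S, resid ε z S a * (1 + ε c / (z c - z a)) / (z a - t) =
        ∑ a ∈ S, resid ε z S a / (z a - t) +
          ε c / (z c - t) * (∑ a ∈ S, resid ε z S a / (z a - t) -
            ∑ a ∈ S, resid ε z S a / (z a - z c)) := by
      rw [← Finset.sum_sub_distrib, Finset.mul_sum, ← Finset.sum_add_distrib]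
      refine Finset.sum_congr rfl fun a ha => ?_
      have h1 := hac a ha
      have h2 := ht a (Finset.mem_insert_of_mem ha)
      rw [show z c - z a = -(z a - z c) by ring]
      field_simp
      ring
    rw [key]
    ring

/-- This compares the t⁻¹ terms at infinity in `prod_one_add_div`; algebraically, the pairwise terms
cancel in the induction. -/
theorem sum_resid (ε z : ι → 𝔽) (S : Finset ι)
    (hz : ∀ a ∈ S, ∀ b ∈ S, a ≠ b → z a - z b ≠ 0) :
    ∑ a ∈ S, resid ε z S a = ∑ a ∈ S, ε a := by
  induction S using Finset.induction_on with
  | empty => simp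
  | insert c S hc ih =>
    have hz' : ∀ a ∈ S, ∀ b ∈ S, a ≠ b → z a - z b ≠ 0 := fun a ha b hb =>
      hz a (Finset.mem_insert_of_mem ha) b (Finset.mem_insert_of_mem hb)
    have hac : ∀ a ∈ S, z a - z c ≠ 0 := fun a ha =>
      hz a (Finset.mem_insert_of_mem ha) c (Finset.mem_insert_self _ _) fun h => hc (h ▸ ha)
    rw [Finset.sum_insert hc, Finset.sum_insert hc, resid_insert_self _ _ hc,
      prod_one_add_div ε z S (z c) hz' hac,
      Finset.sum_congr rfl fun a ha => resid_insert_of_mem ε z hc ha, ← ih hz']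
    have key : ∑ a ∈ S, resid ε z S a * (1 + ε c / (z c - z a)) =
        ∑ a ∈ S, resid ε z S a - ε c * ∑ a ∈ S, resid ε z S a / (z a - z c) := by
      rw [Finset.mul_sum, ← Finset.sum_sub_distrib]
      refine Finset.sum_congr rfl fun a ha => ?_
      have h1 := hac a ha
      rw [show z c - z a = -(z a - z c) by ring]
      field_simp
      ring
    rw [key]
    ring

/-- As a function of z_a the kernel is 1 plus simple poles at x and at w, so the sum is ∑ resid plus
two values of the partial fraction expansion. The constant terms of those expansions cancel against
∑ resid = λ - m. -/
theorem sum_resid_mul (ε z : ι → 𝔽) (S : Finset ι) (lam m w x : 𝔽) (hwx : w - x ≠ 0)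
    (hz : ∀ a ∈ S, ∀ b ∈ S, a ≠ b → z a - z b ≠ 0) (hx : ∀ a ∈ S, z a - x ≠ 0)
    (hw : ∀ a ∈ S, w - z a ≠ 0) (hε : ∑ a ∈ S, ε a = lam - m) :
    ∑ a ∈ S, resid ε z S a *
        ((lam - w + z a) / (w - z a) * (m - z a + x) / (z a - x)) =
      (lam - w + x) / (w - x) * m * ∏ a ∈ S, (1 + ε a / (z a - x)) -
        lam * (m - w + x) / (w - x) * ∏ a ∈ S, (1 + ε a / (z a - w)) := by
  have hw' : ∀ a ∈ S, z a - w ≠ 0 := fun a ha => by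
    rw [← neg_sub]; exact neg_ne_zero.2 (hw a ha)
  rw [prod_one_add_div ε z S x hz hx, prod_one_add_div ε z S w hz hw']
  have key : ∑ a ∈ S, resid ε z S a *
        ((lam - w + z a) / (w - z a) * (m - z a + x) / (z a - x)) =
      ∑ a ∈ S, resid ε z S a +
        (lam - w + x) / (w - x) * m * ∑ a ∈ S, resid ε z S a / (z a - x) -
        lam * (m - w + x) / (w - x) * ∑ a ∈ S, resid ε z S a / (z a - w) := by
    rw [Finset.mul_sum, Finset.mul_sum, ← Finset.sum_add_distrib, ← Finset.sum_sub_distrib]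
    refine Finset.sum_congr rfl fun a ha => ?_
    have h1 := hx a ha
    have h2 := hw a ha
    rw [show z a - w = -(w - z a) by ring]
    field_simp
    ring
  rw [key, sum_resid ε z S hz, hε]
  field_simp
  ring

end PartialFractions

/-! ### The action of `L_{21}` and `L_{11}` -/

/-- The coefficient of `ξ_{I ∪ {j}}` in `Ẽ ξ_I`, after the shift of `λ`. -/
def eCo (lam w y : 𝔽) (z : Fin n → 𝔽) (I : Finset (Fin n)) (j : Fin n) : 𝔽 :=
  -y / (lam * (lam - y)) * ((lam - w + z j) / (w - z j)) * ∏ s ∈ Iᶜ.erase j, gFac y (z j) (z s)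

/-- The vector `Ẽ ξ_I`, after the shift of `λ`. -/
def eVec (lam w y : 𝔽) (z : Fin n → 𝔽) (I : Finset (Fin n)) : Conf n → 𝔽 :=
  ∑ j ∈ Iᶜ, eCo lam w y z I j • xiRec (lam + y) y z (insert j I)

/-- `∏_{j ∉ I} (w - z_j + y) / (w - z_j)` -/
def dProd (w y : 𝔽) (z : Fin n → 𝔽) (I : Finset (Fin n)) : 𝔽 :=
  ∏ j ∈ Iᶜ, (w - z j + y) / (w - z j)

/-- The coefficient of `ξ_I` in `(L_{11} - L_{12} L_{22}⁻¹ L_{21}) ξ_I`. -/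
def dEig (lam w y : 𝔽) (z : Fin n → 𝔽) (I : Finset (Fin n)) : 𝔽 :=
  (lam + ((n : 𝔽) - 2 * (I.card : 𝔽) - 1) * y) / (lam - y) * dProd w y z I

theorem eCo_insert (lam w y : 𝔽) (z : Fin (n + 1) → 𝔽) (I : Finset (Fin n)) (j : Fin n) :
    eCo lam w y z (insert 0 (upF I)) j.succ = eCo lam w y (Fin.tail z) I j := by
  simp [eCo, Fin.tail]

theorem eCo_up (lam w y : 𝔽) (z : Fin (n + 1) → 𝔽) (I : Finset (Fin n)) (j : Fin n) :
    eCo lam w y z (upF I) j.succ = gFac y (z j.succ) (z 0) * eCo lam w y (Fin.tail z) I j := by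
  rw [eCo, eCo, compl_upF, insert_upF_erase_succ, prod_insert_upF]
  simp only [Fin.tail]
  ring

theorem eCo_up_zero (lam w y : 𝔽) (z : Fin (n + 1) → 𝔽) (I : Finset (Fin n)) :
    eCo lam w y z (upF I) 0 = -y / (lam * (lam - y)) * ((lam - w + z 0) / (w - z 0)) *
      ∏ s ∈ Iᶜ, gFac y (z 0) (z s.succ) := by
  rw [eCo, compl_upF, insert_upF_erase_zero, prod_upF]

theorem compl_erase_eq {I : Finset (Fin n)} {p : Fin n} : (I.erase p)ᶜ = insert p Iᶜ :=
  Finset.compl_erase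

theorem eCo_erase (lam w y : 𝔽) (z : Fin n → 𝔽) {I : Finset (Fin n)} {p j : Fin n}
    (hp : p ∈ I) (hj : j ∈ Iᶜ) :
    eCo lam w y z (I.erase p) j = gFac y (z j) (z p) * eCo lam w y z I j := by
  have hpj : p ≠ j := fun h => (Finset.mem_compl.1 hj) (h ▸ hp)
  have hp' : p ∉ Iᶜ.erase j := fun h => (Finset.mem_compl.1 (Finset.mem_of_mem_erase h)) hp
  rw [eCo, eCo, compl_erase_eq, Finset.erase_insert_of_ne hpj, Finset.prod_insert hp']
  ring

theorem eCo_erase_self (lam w y : 𝔽) (z : Fin n → 𝔽) {I : Finset (Fin n)} {p : Fin n}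
    (hp : p ∈ I) :
    eCo lam w y z (I.erase p) p = -y / (lam * (lam - y)) * ((lam - w + z p) / (w - z p)) *
      ∏ s ∈ Iᶜ, gFac y (z p) (z s) := by
  rw [eCo, compl_erase_eq, Finset.erase_insert (by simpa using hp)]

theorem dProd_up (w y : 𝔽) (z : Fin (n + 1) → 𝔽) (I : Finset (Fin n)) :
    dProd w y z (upF I) = (w - z 0 + y) / (w - z 0) * dProd w y (Fin.tail z) I := by
  rw [dProd, compl_upF, prod_insert_upF]; rfl

theorem dProd_insert (w y : 𝔽) (z : Fin (n + 1) → 𝔽) (I : Finset (Fin n)) :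
    dProd w y z (insert 0 (upF I)) = dProd w y (Fin.tail z) I := by
  rw [dProd, compl_insert_upF, prod_upF]; rfl

theorem dProd_erase (w y : 𝔽) (z : Fin n → 𝔽) {I : Finset (Fin n)} {p : Fin n} (hp : p ∈ I) :
    dProd w y z (I.erase p) = (w - z p + y) / (w - z p) * dProd w y z I := by
  rw [dProd, compl_erase_eq, Finset.prod_insert (by simpa using hp)]; rfl

theorem gFac_eq_left {y a b : 𝔽} (h : a - b ≠ 0) : gFac y a b = 1 + y / (a - b) := by
  rw [gFac]; field_simp

theorem gFac_eq_right {y a b : 𝔽} (h : a - b ≠ 0) : gFac y a b = 1 + -y / (b - a) := by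
  rw [gFac, show b - a = -(a - b) by ring]; field_simp

/-- With ε = y on I and -y off I, one product over all points encodes the mixed products over I and
its complement. -/
theorem prod_sign {M : Type*} [CommMonoid M] (I S : Finset (Fin n)) (F : Fin n → 𝔽 → M) (y : 𝔽) :
    ∏ b ∈ S, F b (if b ∈ I then y else -y) =
      (∏ b ∈ S ∩ I, F b y) * ∏ b ∈ S ∩ Iᶜ, F b (-y) := by
  rw [← Finset.prod_filter_mul_prod_filter_not S (· ∈ I), Finset.filter_mem_eq_inter]
  congr 1
  · exact Finset.prod_congr rfl fun b hb => by rw [if_pos (Finset.mem_inter.1 hb).2]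
  · have : S.filter (· ∉ I) = S ∩ Iᶜ := by ext; simp
    rw [this]
    exact Finset.prod_congr rfl fun b hb => by
      rw [if_neg (Finset.mem_compl.1 (Finset.mem_inter.1 hb).2)]

/-- The coefficient `κ` in the recursion for `L_{21}` and `L_{11}`. -/
def kappa (lam w y : 𝔽) (z : Fin (n + 1) → 𝔽) (I : Finset (Fin n)) : 𝔽 :=
  eCo lam w y z (upF I) 0 * (lam + y + ((n : 𝔽) - 1 - 2 * (I.card : 𝔽)) * y) +
    ∑ j ∈ Iᶜ, eCo lam w y z (upF I) j.succ *
      cCo (lam + y) y (z 0) (Fin.tail z) (insert j I) j -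
    ∑ p ∈ I, cCo (lam - y) y (z 0) (Fin.tail z) I p * eCo lam w y (Fin.tail z) (I.erase p) p

/-- Up to common factors, the two sums in κ are the parts over Iᶜ and over I of one sum over all
points, which `sum_resid_mul` evaluates. Its value at the pole x = z_0 cancels the term of κ that
inserts the point 0, and the value at w remains. -/
theorem kappa_mul_aEig {lam w y : 𝔽} {z : Fin (n + 1) → 𝔽} (hg : Generic lam w y z)
    (I : Finset (Fin n)) :
    kappa lam w y z I * aEig w y (Fin.tail z) I =
      -y * (lam + ((n : 𝔽) - 2 * (I.card : 𝔽)) * y - w + z 0) / ((lam - y) * (w - z 0)) *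
        (hProd y (z 0) (Fin.tail z) I * dProd w y (Fin.tail z) I) := by
  have hx := hg.w_ne 0
  have hl : lam ≠ 0 := by simpa using hg.lam_ne 0
  have hly : lam - y ≠ 0 := by
    have := hg.lam_ne (-1)
    push_cast at this
    rwa [neg_one_mul, ← sub_eq_add_neg] at this
  have hz : ∀ i : Fin n, z i.succ - z 0 ≠ 0 := fun i => hg.z_ne _ _ (Fin.succ_ne_zero i)
  have hz' : ∀ i : Fin n, z 0 - z i.succ ≠ 0 := fun i => hg.z_ne _ _ (Fin.succ_ne_zero i).symm
  have hzy : ∀ i : Fin n, z i.succ - z 0 + y ≠ 0 := fun i => hg.zy_ne _ _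
  have hw : ∀ i : Fin n, w - z i.succ ≠ 0 := fun i => hg.w_ne _
  have hwy : ∀ i : Fin n, w - z i.succ - y ≠ 0 := fun i => hg.wy_ne _
  have hzz : ∀ i j : Fin n, i ≠ j → z i.succ - z j.succ ≠ 0 := fun i j h =>
    hg.z_ne _ _ (by simpa using h)
  -- The signs make all coefficients residues of one function. Their sum is y times the weight of
  -- ξ_I, so `m` below is the dynamical parameter shifted by that weight.
  set ε : Fin n → 𝔽 := fun a => if a ∈ I then y else -y with hε
  set m : 𝔽 := lam + ((n : 𝔽) - 2 * (I.card : 𝔽)) * y with hm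
  set H := hProd y (z 0) (Fin.tail z) I with hH
  have hεsum : ∑ a, ε a = lam - m := by
    have h1 := Finset.sum_add_sum_compl I ε
    rw [← h1, Finset.sum_congr rfl fun a ha => show ε a = y by simp [hε, ha],
      Finset.sum_congr rfl fun a ha => show ε a = -y by simp [hε, Finset.mem_compl.1 ha]]
    rw [Finset.sum_const, Finset.sum_const, Finset.card_compl, Fintype.card_fin, nsmul_eq_mul,
      nsmul_eq_mul, Nat.cast_sub (by simpa using Finset.card_le_univ I), hm]
    ring
  have main := sum_resid_mul ε (Fin.tail z) Finset.univ lam m w (z 0) hx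
    (fun a _ b _ h => hzz a b h) (fun a _ => hz a) (fun a _ => hw a) hεsum
  have hG : ∀ t : 𝔽, (∀ i : Fin n, z i.succ - t ≠ 0) →
      ∏ a, (1 + ε a / (Fin.tail z a - t)) =
        (∏ q ∈ I, gFac y (Fin.tail z q) t) * ∏ s ∈ Iᶜ, gFac y t (Fin.tail z s) := by
    intro t ht
    rw [prod_sign I Finset.univ (fun a e => 1 + e / (Fin.tail z a - t)) y, Finset.univ_inter,
      Finset.univ_inter]
    congr 1
    · exact Finset.prod_congr rfl fun q _ => (gFac_eq_left (ht q)).symm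
    · exact Finset.prod_congr rfl fun q _ => (gFac_eq_right (by
        rw [← neg_sub]; exact neg_ne_zero.2 (ht q))).symm
  have hr1 : ∀ p ∈ I, resid ε (Fin.tail z) Finset.univ p =
      y * (gProd y (Fin.tail z) I p * ∏ s ∈ Iᶜ, gFac y (Fin.tail z p) (Fin.tail z s)) := by
    intro p hp
    rw [resid, prod_sign I (Finset.univ.erase p)
      (fun a e => 1 + e / (Fin.tail z a - Fin.tail z p)) y, gProd]
    have e1 : Finset.univ.erase p ∩ I = I.erase p := by ext; simp
    have e2 : Finset.univ.erase p ∩ Iᶜ = Iᶜ := by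
      ext a; simp only [Finset.mem_inter, Finset.mem_erase, Finset.mem_univ, and_true,
        Finset.mem_compl, and_iff_right_iff_imp]
      rintro h rfl; exact h hp
    rw [e1, e2]
    congr 1
    · simp [hε, hp]
    congr 1
    · exact Finset.prod_congr rfl fun q hq =>
        (gFac_eq_left (hzz _ _ (Finset.ne_of_mem_erase hq))).symm
    · exact Finset.prod_congr rfl fun q hq =>
        (gFac_eq_right (hzz _ _ (ne_of_mem_of_not_mem hp (Finset.mem_compl.1 hq)))).symm
  have hr2 : ∀ j ∈ Iᶜ, resid ε (Fin.tail z) Finset.univ j =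
      -y * ((∏ q ∈ I, gFac y (Fin.tail z q) (Fin.tail z j)) *
        ∏ s ∈ Iᶜ.erase j, gFac y (Fin.tail z j) (Fin.tail z s)) := by
    intro p hp
    have hp' := Finset.mem_compl.1 hp
    rw [resid, prod_sign I (Finset.univ.erase p)
      (fun a e => 1 + e / (Fin.tail z a - Fin.tail z p)) y]
    have e1 : Finset.univ.erase p ∩ Iᶜ = Iᶜ.erase p := by ext; simp
    have e2 : Finset.univ.erase p ∩ I = I := by
      ext a; simp only [Finset.mem_inter, Finset.mem_erase, Finset.mem_univ, and_true,
        and_iff_right_iff_imp]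
      rintro h rfl; exact hp' h
    rw [e1, e2]
    congr 1
    · simp [hε, hp']
    congr 1
    · exact Finset.prod_congr rfl fun q hq =>
        (gFac_eq_left (hzz _ _ (ne_of_mem_of_not_mem hq hp'))).symm
    · exact Finset.prod_congr rfl fun q hq =>
        (gFac_eq_right (hzz _ _ (Finset.ne_of_mem_erase hq).symm)).symm
  have s1 : ∑ j ∈ Iᶜ, eCo lam w y z (upF I) j.succ *
      cCo (lam + y) y (z 0) (Fin.tail z) (insert j I) j =
      y / (lam * (lam - y)) * H * ∑ j ∈ Iᶜ, resid ε (Fin.tail z) Finset.univ j *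
        ((lam - w + Fin.tail z j) / (w - Fin.tail z j) * (m - Fin.tail z j + z 0) /
          (Fin.tail z j - z 0)) := by
    rw [Finset.mul_sum]
    refine Finset.sum_congr rfl fun j hj => ?_
    have hj' := Finset.mem_compl.1 hj
    rw [hr2 j hj, eCo_up, eCo, cCo, Finset.erase_insert hj', Finset.card_insert_of_notMem hj']
    simp only [tail_apply, gFac, hm, ← hH]
    have h1 := hz j
    have h2 := hzy j
    have h3 := hw j
    push_cast
    field_simp
    ring
  have s2 : ∑ p ∈ I, cCo (lam - y) y (z 0) (Fin.tail z) I p *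
      eCo lam w y (Fin.tail z) (I.erase p) p =
      -y / (lam * (lam - y)) * H * ∑ p ∈ I, resid ε (Fin.tail z) Finset.univ p *
        ((lam - w + Fin.tail z p) / (w - Fin.tail z p) * (m - Fin.tail z p + z 0) /
          (Fin.tail z p - z 0)) := by
    rw [Finset.mul_sum]
    refine Finset.sum_congr rfl fun p hp => ?_
    rw [hr1 p hp, eCo_erase_self _ _ _ _ hp, cCo_eq, hH, hProd_erase _ _ _ hp]
    simp only [tail_apply, hm]
    have h1 := hz p
    have h2 := hzy p
    have h3 := hw p
    field_simp
    ring
  have hHG : H * ∏ q ∈ I, gFac y (Fin.tail z q) (z 0) = 1 := hProd_mul_gFac hg I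
  -- The I-part of the product at t = w is the inverse of the eigenvalue a_I; the Iᶜ-part is `dProd`
  -- (`hwD`).
  have hwG : (∏ q ∈ I, gFac y (Fin.tail z q) w) * aEig w y (Fin.tail z) I = 1 := by
    rw [aEig, ← Finset.prod_mul_distrib]
    refine Finset.prod_eq_one fun q _ => ?_
    have h1 := hw q
    have h2 := hwy q
    rw [tail_apply, gFac, show z q.succ - w + y = -(w - z q.succ - y) by ring,
      show z q.succ - w = -(w - z q.succ) by ring]
    field_simp
  have hwD : ∏ s ∈ Iᶜ, gFac y w (Fin.tail z s) = dProd w y (Fin.tail z) I := rfl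
  rw [← Finset.sum_add_sum_compl I, hG (z 0) hz, hG w fun i => by
    rw [← neg_sub]; exact neg_ne_zero.2 (hw i), hwD] at main
  rw [kappa, s1, s2, eCo_up_zero]
  have e0 : ∏ s ∈ Iᶜ, gFac y (z 0) (z s.succ) = ∏ s ∈ Iᶜ, gFac y (z 0) (Fin.tail z s) := rfl
  rw [e0]
  set SI := ∑ p ∈ I, resid ε (Fin.tail z) Finset.univ p *
        ((lam - w + Fin.tail z p) / (w - Fin.tail z p) * (m - Fin.tail z p + z 0) /
          (Fin.tail z p - z 0))
  set SC := ∑ p ∈ Iᶜ, resid ε (Fin.tail z) Finset.univ p *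
        ((lam - w + Fin.tail z p) / (w - Fin.tail z p) * (m - Fin.tail z p + z 0) /
          (Fin.tail z p - z 0))
  generalize ∏ s ∈ Iᶜ, gFac y (z 0) (Fin.tail z s) = PC at *
  generalize ∏ q ∈ I, gFac y (Fin.tail z q) (z 0) = PI at *
  generalize ∏ q ∈ I, gFac y (Fin.tail z q) w = PW at *
  generalize aEig w y (Fin.tail z) I = a at *
  generalize dProd w y (Fin.tail z) I = D at *
  have hm' : lam + y + ((n : 𝔽) - 1 - 2 * (I.card : 𝔽)) * y = m := by rw [hm]; ring
  rw [hm']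
  clear_value SI SC H m
  clear hm hm' s1 s2 hr1 hr2 hG hεsum hwD e0
  -- `hHG` cancels the value at z_0 against the inserted point 0, and `hwG` removes a_I from the
  -- value at w.
  linear_combination (norm := (field_simp; ring)) y / (lam * (lam - y)) * H * a * main +
    a * y / (lam * (lam - y)) * ((lam - w + z 0) / (w - z 0) * m) * PC * hHG -
    y / (lam * (lam - y)) * H * (lam * (m - w + z 0) / (w - z 0)) * D * hwG

end Generic

/-! ### Induction for L_{21} and L_{11}. -/

section Generic

variable {𝔽 : Type*} [Field 𝔽] {n : ℕ}

theorem Generic.lam_ne_zero {lam w y : 𝔽} {z : Fin n → 𝔽} (hg : Generic lam w y z) : lam ≠ 0 := by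
  simpa using hg.lam_ne 0

theorem Generic.lam_sub_ne_zero {lam w y : 𝔽} {z : Fin n → 𝔽} (hg : Generic lam w y z) :
    lam - y ≠ 0 := by
  simpa [sub_eq_add_neg] using hg.lam_ne (-1)

theorem smul_vec {X : Type*} (c : 𝔽) (A B : X → 𝔽) :
    c • (![A, B] : Fin 2 → X → 𝔽) = ![c • A, c • B] := by simp

theorem neg_vcons (A B : Conf n → 𝔽) : -vcons A B = vcons (-A) (-B) := by
  funext s; simp only [vcons, Pi.neg_apply]; split_ifs <;> rfl

theorem eVec_insert (lam w y : 𝔽) (z : Fin (n + 1) → 𝔽) (I : Finset (Fin n)) :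
    eVec lam w y z (insert 0 (upF I)) =
      vcons ((lam + ((n : 𝔽) - 2 - 2 * (I.card : 𝔽)) * y) • eVec lam w y (Fin.tail z) I) 0 := by
  funext s
  obtain ⟨b, s, rfl⟩ := exists_eq_cons s
  simp only [eVec, compl_insert_upF, sum_upF, insert_upF_insert_succ, xiRec_insert, eCo_insert]
  fin_cases b
  · simp only [Fin.zero_eta, Finset.sum_apply, Pi.smul_apply, smul_eq_mul, vcons_cons_zero,
      Finset.mul_sum]
    refine Finset.sum_congr rfl fun j hj => ?_
    rw [Finset.card_insert_of_notMem (Finset.mem_compl.1 hj)]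
    push_cast; ring
  · simp

/-- Shifting λ by -y in ξ, or adding a point to I and shifting by +y in e, yields the same
prefactor. The whole vector is thus a multiple of the one for n points. -/
theorem Lop_eta_insert {lam w y : 𝔽} {z : Fin (n + 1) → 𝔽} (I : Finset (Fin n))
    (ih : Lop lam w y (Fin.tail z) ![xiRec (lam - y) y (Fin.tail z) I,
        -eVec lam w y (Fin.tail z) I] =
      dEig lam w y (Fin.tail z) I • ![xiRec lam y (Fin.tail z) I, 0]) :
    Lop lam w y z ![xiRec (lam - y) y z (insert 0 (upF I)), -eVec lam w y z (insert 0 (upF I))] =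
      dEig lam w y z (insert 0 (upF I)) • ![xiRec lam y z (insert 0 (upF I)), 0] := by
  have hv : (![(lam - y + ((n : 𝔽) - 1 - 2 * (I.card : 𝔽)) * y) • xiRec (lam - y) y (Fin.tail z) I,
      -((lam + ((n : 𝔽) - 2 - 2 * (I.card : 𝔽)) * y) • eVec lam w y (Fin.tail z) I)] :
        Fin 2 → Conf n → 𝔽) =
      (lam + ((n : 𝔽) - 2 - 2 * (I.card : 𝔽)) * y) •
        ![xiRec (lam - y) y (Fin.tail z) I, -eVec lam w y (Fin.tail z) I] := by
    rw [smul_vec, smul_neg]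
    congr 2
    ring
  rw [xiRec_insert, xiRec_insert, eVec_insert, neg_vcons, neg_zero, dEig, dProd_insert,
    card_insert_upF]
  rw [dEig] at ih
  funext c s
  obtain ⟨b, s, rfl⟩ := exists_eq_cons s
  fin_cases c <;> fin_cases b
  · simp only [Fin.zero_eta, Lop_zero_zero, hv, map_smul, ih]
    simp only [Pi.smul_apply, Matrix.cons_val_zero, smul_eq_mul, vcons_cons_zero]
    push_cast
    ring
  · simp only [Fin.zero_eta, Fin.mk_one, Lop_zero_one, hv, map_smul, ih, vec_zero_zero, map_zero]
    simp
  · simp only [Fin.zero_eta, Fin.mk_one, Lop_one_zero, hv, map_smul, ih, vec_zero_zero, map_zero]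
    simp
  · simp only [Fin.mk_one, Lop_one_one, vec_zero_zero, map_zero]
    simp

/-- In the v_1-component a point j is inserted and a point p removed. For p ≠ j the two operations
commute and give the sum of e_{I - {p}}; the terms that return to ξ_I, together with the insertion
of 0, are collected in κ. -/
theorem eVec_up {lam w y : 𝔽} {z : Fin (n + 1) → 𝔽} (hg : Generic lam w y z)
    (I : Finset (Fin n)) :
    eVec lam w y z (upF I) =
      vcons (kappa lam w y z I • xiRec (lam + y) y (Fin.tail z) I +
        ∑ p ∈ I, cCo (lam - y) y (z 0) (Fin.tail z) I p • eVec lam w y (Fin.tail z) (I.erase p))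
      (hProd y (z 0) (Fin.tail z) I • eVec lam w y (Fin.tail z) I) := by
  have hz : ∀ i : Fin n, z i.succ - z 0 ≠ 0 := fun i => hg.z_ne _ _ (Fin.succ_ne_zero i)
  have hzy : ∀ i : Fin n, z i.succ - z 0 + y ≠ 0 := fun i => hg.zy_ne _ _
  funext s
  obtain ⟨b, s, rfl⟩ := exists_eq_cons s
  rw [eVec, compl_upF, sum_insert_upF]
  simp only [xiRec_insert, upF_insert_succ, xiRec_up]
  fin_cases b
  · simp only [Fin.zero_eta, Finset.sum_apply, Pi.add_apply, Pi.smul_apply, smul_eq_mul,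
      vcons_cons_zero]
    have e1 : ∀ j ∈ Iᶜ, ∑ p ∈ insert j I, cCo (lam + y) y (z 0) (Fin.tail z) (insert j I) p *
        xiRec (lam + y) y (Fin.tail z) ((insert j I).erase p) s =
        cCo (lam + y) y (z 0) (Fin.tail z) (insert j I) j * xiRec (lam + y) y (Fin.tail z) I s +
        ∑ p ∈ I, cCo (lam + y) y (z 0) (Fin.tail z) (insert j I) p *
          xiRec (lam + y) y (Fin.tail z) (insert j (I.erase p)) s := by
      intro j hj
      have hj' := Finset.mem_compl.1 hj
      rw [Finset.sum_insert hj', Finset.erase_insert hj']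
      congr 1
      exact Finset.sum_congr rfl fun p hp => by
        rw [Finset.erase_insert_of_ne (ne_of_mem_of_not_mem hp hj').symm]
    have e2 : ∀ p ∈ I, eVec lam w y (Fin.tail z) (I.erase p) s =
        eCo lam w y (Fin.tail z) (I.erase p) p * xiRec (lam + y) y (Fin.tail z) I s +
        ∑ j ∈ Iᶜ, eCo lam w y (Fin.tail z) (I.erase p) j *
          xiRec (lam + y) y (Fin.tail z) (insert j (I.erase p)) s := by
      intro p hp
      rw [eVec, compl_erase_eq, Finset.sum_insert (by simpa using hp), Finset.insert_erase hp]
      simp only [Finset.sum_apply, Pi.add_apply, Pi.smul_apply, smul_eq_mul]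
    -- Insertion and removal commute: the shifts λ + y and λ - y compensate the change of |I|, and
    -- the extra factors for the pair j, p and for j, 0 cancel.
    have e3 : ∀ j ∈ Iᶜ, ∀ p ∈ I, eCo lam w y z (upF I) j.succ *
        cCo (lam + y) y (z 0) (Fin.tail z) (insert j I) p =
        cCo (lam - y) y (z 0) (Fin.tail z) I p * eCo lam w y (Fin.tail z) (I.erase p) j := by
      intro j hj p hp
      have hj' := Finset.mem_compl.1 hj
      have hpj := ne_of_mem_of_not_mem hp hj'
      rw [eCo_up, eCo_erase _ _ _ _ hp hj, cCo_eq, cCo_eq, Finset.card_insert_of_notMem hj',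
        Finset.erase_insert_of_ne hpj.symm, hProd,
        Finset.prod_insert fun h => hj' (Finset.mem_of_mem_erase h),
        gProd_erase (j := j) y (Fin.tail z) (Finset.mem_erase.2 ⟨hpj.symm, Finset.mem_insert_self _ _⟩),
        Finset.erase_insert hj', ← hProd]
      have h1 := hz j
      have h2 := hzy j
      have h3 : z j.succ - z p.succ ≠ 0 := hg.z_ne _ _ (by simpa using hpj.symm)
      simp only [tail_apply, gFac]
      push_cast
      field_simp
      ring
    rw [Finset.sum_congr rfl fun j hj => by rw [e1 j hj],
      Finset.sum_congr (s₁ := I) rfl fun p hp => by rw [e2 p hp], kappa]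
    simp only [mul_add, Finset.sum_add_distrib, sub_mul, add_mul, Finset.sum_mul, Finset.mul_sum,
      ← mul_assoc]
    have e4 : ∑ j ∈ Iᶜ, ∑ p ∈ I, eCo lam w y z (upF I) j.succ *
        cCo (lam + y) y (z 0) (Fin.tail z) (insert j I) p *
          xiRec (lam + y) y (Fin.tail z) (insert j (I.erase p)) s =
        ∑ p ∈ I, ∑ j ∈ Iᶜ, cCo (lam - y) y (z 0) (Fin.tail z) I p *
          eCo lam w y (Fin.tail z) (I.erase p) j *
          xiRec (lam + y) y (Fin.tail z) (insert j (I.erase p)) s := by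
      rw [Finset.sum_comm]
      exact Finset.sum_congr rfl fun p hp => Finset.sum_congr rfl fun j hj => by
        rw [e3 j hj p hp]
    rw [e4]
    ring
  · simp only [Fin.mk_one, eVec, Finset.sum_apply, Pi.add_apply, Pi.smul_apply, smul_eq_mul,
      vcons_cons_one, Pi.zero_apply, mul_zero, zero_add, Finset.mul_sum]
    refine Finset.sum_congr rfl fun j hj => ?_
    have hj' := Finset.mem_compl.1 hj
    rw [eCo_up, hProd, Finset.prod_insert hj', ← hProd, tail_apply, gFac]
    have h1 := hz j
    have h2 := hzy j
    field_simp

/-- The vector for n + 1 points splits into vectors of the same kind and a defect -κ v_2 ⊗ ξ_I(λ +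
y). On the defect L acts by `Lop_xi`, which produces exactly the product κ a_I known in closed form.
-/
theorem Lop_eta_up [NeZero (2 : 𝔽)] {lam w y : 𝔽} {z : Fin (n + 1) → 𝔽} (hg : Generic lam w y z)
    (I : Finset (Fin n))
    (ih : ∀ I, Lop lam w y (Fin.tail z) ![xiRec (lam - y) y (Fin.tail z) I,
        -eVec lam w y (Fin.tail z) I] =
      dEig lam w y (Fin.tail z) I • ![xiRec lam y (Fin.tail z) I, 0]) :
    Lop lam w y z ![xiRec (lam - y) y z (upF I), -eVec lam w y z (upF I)] =
      dEig lam w y z (upF I) • ![xiRec lam y z (upF I), 0] := by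
  have hx := hg.w_ne 0
  have hxy := hg.wy_ne 0
  have hly := hg.lam_sub_ne_zero
  have hw : ∀ i : Fin n, w - z i.succ ≠ 0 := fun i => hg.w_ne _
  have hz : ∀ i : Fin n, z i.succ - z 0 ≠ 0 := fun i => hg.z_ne _ _ (Fin.succ_ne_zero i)
  have hzy : ∀ i : Fin n, z i.succ - z 0 + y ≠ 0 := fun i => hg.zy_ne _ _
  have hL := fun s : Conf n => hg.weight_ne (wtSum s)
  have hwt : ∀ s : Conf n, xiRec lam y (Fin.tail z) I s = 0 ∨
      wtSum s = 2 * I.card - n := fun s => by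
    by_contra! h; exact h.1 (xiRec_eq_zero _ _ _ _ _ h.2)
  have hκ := kappa_mul_aEig hg I
  have h1 : (![hProd y (z 0) (Fin.tail z) I • xiRec (lam - y) y (Fin.tail z) I,
      -(hProd y (z 0) (Fin.tail z) I • eVec lam w y (Fin.tail z) I)] : Fin 2 → Conf n → 𝔽) =
      hProd y (z 0) (Fin.tail z) I •
        ![xiRec (lam - y) y (Fin.tail z) I, -eVec lam w y (Fin.tail z) I] := by
    rw [smul_vec, smul_neg]
  have h0 : (![∑ p ∈ I, cCo (lam - y) y (z 0) (Fin.tail z) I p •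
        xiRec (lam - y) y (Fin.tail z) (I.erase p),
      -(kappa lam w y z I • xiRec (lam + y) y (Fin.tail z) I +
        ∑ p ∈ I, cCo (lam - y) y (z 0) (Fin.tail z) I p • eVec lam w y (Fin.tail z) (I.erase p))] :
          Fin 2 → Conf n → 𝔽) =
      ∑ p ∈ I, cCo (lam - y) y (z 0) (Fin.tail z) I p •
        ![xiRec (lam - y) y (Fin.tail z) (I.erase p), -eVec lam w y (Fin.tail z) (I.erase p)] -
      kappa lam w y z I • ![0, xiRec (lam + y) y (Fin.tail z) I] := by
    funext d s
    fin_cases d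
    · simp [Finset.sum_apply]
    · simp [Finset.sum_apply, sub_eq_add_neg]
  rw [xiRec_up, eVec_up hg, neg_vcons, xiRec_up]
  funext c s
  obtain ⟨b, s, rfl⟩ := exists_eq_cons s
  simp only [dEig, dProd_up, card_upF]
  fin_cases c <;> fin_cases b
  · simp only [Fin.zero_eta, Lop_zero_zero, h0, map_sub, map_sum, map_smul, ih,
      Lop_xi hg.tail]
    simp only [fVec, Pi.sub_apply, Pi.smul_apply, Matrix.cons_val_zero, Finset.sum_apply,
      smul_eq_mul, vcons_cons_zero, ← mul_assoc, hκ]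
    simp only [Finset.mul_sum, ← Finset.sum_sub_distrib]
    refine Finset.sum_congr rfl fun p hp => ?_
    rw [dEig, fCo, cCo_eq, cCo_eq, hProd_erase _ _ _ hp, dProd_erase _ _ _ hp,
      cast_card_erase hp]
    simp only [tail_apply]
    have h1 := hw p
    have h2 := hz p
    have h3 := hzy p
    push_cast
    field_simp
    ring
  · simp only [Fin.zero_eta, Fin.mk_one, Lop_zero_one, h0, h1, map_sub, map_sum, map_smul, ih,
      Lop_xi hg.tail]
    simp only [Pi.sub_apply, Pi.smul_apply, Matrix.cons_val_zero, Matrix.cons_val_one,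
      Matrix.cons_val_fin_one, Finset.sum_apply, Pi.zero_apply,
      smul_eq_mul, vcons_cons_one, ← mul_assoc, hκ, mul_zero, Finset.sum_const_zero, zero_sub]
    rcases hwt s with h | h
    · simp [h]
    have hL := hL s
    rw [h] at hL ⊢
    simp only [Rmat, dEig]
    push_cast at hL ⊢
    field_simp
    ring
  · simp only [Fin.zero_eta, Fin.mk_one, Lop_one_zero, h0, h1, map_sub, map_sum, map_smul, ih,
      Lop_xi hg.tail]
    simp only [Pi.sub_apply, Pi.smul_apply, Matrix.cons_val_zero, Matrix.cons_val_one,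
      Matrix.cons_val_fin_one, Finset.sum_apply, Pi.zero_apply,
      smul_eq_mul, ← mul_assoc, hκ, mul_zero, Finset.sum_const_zero, zero_sub]
    rcases hwt s with h | h
    · simp [h]
    have hL := hL s
    rw [h] at hL ⊢
    simp only [Rmat, dEig]
    push_cast at hL ⊢
    field_simp
    ring
  · simp only [Fin.mk_one, Lop_one_one, h1, map_smul, ih]
    simp

/-- The vanishing v_2-row is the statement about Ẽ. The v_1-row with the eigenvalue d_I is carried
along because the induction needs it. -/
theorem Lop_eta [NeZero (2 : 𝔽)] {lam w y : 𝔽} {z : Fin n → 𝔽} (hg : Generic lam w y z)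
    (I : Finset (Fin n)) :
    Lop lam w y z ![xiRec (lam - y) y z I, -eVec lam w y z I] =
      dEig lam w y z I • ![xiRec lam y z I, 0] := by
  induction n with
  | zero =>
    have hly := hg.lam_sub_ne_zero
    rw [Lop_zero, Finset.eq_empty_of_isEmpty I]
    have : lam + -y ≠ 0 := by rwa [← sub_eq_add_neg]
    simp [dEig, dProd, eVec, xiRec, sub_eq_add_neg, this]
  | succ n ih =>
    induction I using finset_fin_succ_cases with
    | h0 I => exact Lop_eta_insert I (ih hg.tail I)
    | h1 I => exact Lop_eta_up hg I (ih hg.tail)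

end Generic

/-! ### Sums over permutations -/

theorem sum_perm_fin_succ {M : Type*} [AddCommMonoid M] {k : ℕ}
    (F : (Fin (k + 1) → Fin (k + 1)) → M) :
    ∑ τ : Equiv.Perm (Fin (k + 1)), F τ =
      ∑ p, ∑ σ : Equiv.Perm (Fin k), F (Fin.cons p fun q => p.succAbove (σ q)) := by
  -- A permutation is its value p at 0 and a permutation of the rest; the inverse of `cycleRange`
  -- sends 0 to p and q + 1 to `p.succAbove q`.
  let Φ : Fin (k + 1) × Equiv.Perm (Fin k) → Equiv.Perm (Fin (k + 1)) := fun x =>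
    x.1.cycleRange.symm * Equiv.Perm.decomposeFin.symm (0, x.2)
  have hΦ : ∀ x, (Φ x : Fin (k + 1) → Fin (k + 1)) =
      Fin.cons x.1 fun q => x.1.succAbove (x.2 q) := by
    rintro ⟨p, σ⟩
    funext q
    induction q using Fin.cases with
    | zero => simp [Φ]
    | succ q => simp [Φ]
  have hinj : Function.Injective Φ := by
    rintro ⟨p, σ⟩ ⟨p', σ'⟩ h
    have h' := congrArg (fun τ : Equiv.Perm (Fin (k + 1)) => (τ : Fin (k + 1) → Fin (k + 1))) h
    simp only [hΦ, Fin.cons_inj] at h'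
    obtain ⟨rfl, h2⟩ := h'
    refine Prod.ext rfl (Equiv.ext fun q => ?_)
    exact Fin.succAbove_right_injective (congrFun h2 q)
  have hbij : Function.Bijective Φ := by
    rw [Fintype.bijective_iff_injective_and_card]
    refine ⟨hinj, ?_⟩
    simp [Fintype.card_perm, Nat.factorial_succ]
  rw [← Fintype.sum_prod_type']
  exact (Fintype.sum_bijective Φ hbij _ _ fun x => by rw [hΦ]).symm

theorem prod_orderEmbOfFin {M ι : Type*} [CommMonoid M] [LinearOrder ι] {k : ℕ} (I : Finset ι)
    (h : I.card = k) (f : ι → M) : ∏ r, f (I.orderEmbOfFin h r) = ∏ i ∈ I, f i := by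
  conv_rhs => rw [← Finset.image_orderEmbOfFin_univ I h]
  rw [Finset.prod_image fun a _ b _ hab => (I.orderEmbOfFin h).injective hab]

theorem sum_orderEmbOfFin {M ι : Type*} [AddCommMonoid M] [LinearOrder ι] {k : ℕ} (I : Finset ι)
    (h : I.card = k) (f : ι → M) : ∑ r, f (I.orderEmbOfFin h r) = ∑ i ∈ I, f i := by
  conv_rhs => rw [← Finset.image_orderEmbOfFin_univ I h]
  rw [Finset.sum_image fun a _ b _ hab => (I.orderEmbOfFin h).injective hab]

section OrderEmb

variable {n k : ℕ}

theorem orderEmbOfFin_upF (I : Finset (Fin n)) (h : I.card = k) (h' : (upF I).card = k)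
    (r : Fin k) : (upF I).orderEmbOfFin h' r = (I.orderEmbOfFin h r).succ := by
  have := Finset.orderEmbOfFin_unique h' (f := fun r => (I.orderEmbOfFin h r).succ)
    (fun r => by simp [Finset.orderEmbOfFin_mem])
    (fun a b hab => Fin.succ_lt_succ_iff.2 ((I.orderEmbOfFin h).strictMono hab))
  exact (congrFun this r).symm

theorem orderEmbOfFin_insert_upF (I : Finset (Fin n)) (h : I.card = k)
    (h' : (insert 0 (upF I)).card = k + 1) :
    ⇑((insert 0 (upF I)).orderEmbOfFin h') =
      (Fin.cons 0 fun r => (I.orderEmbOfFin h r).succ : Fin (k + 1) → Fin (n + 1)) := by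
  refine (Finset.orderEmbOfFin_unique h' (fun r => ?_) ?_).symm
  · induction r using Fin.cases <;> simp [Finset.orderEmbOfFin_mem]
  · intro a b hab
    induction b using Fin.cases with
    | zero => exact absurd hab (Fin.not_lt_zero a)
    | succ b =>
      induction a using Fin.cases with
      | zero => simp
      | succ a =>
        simp only [Fin.cons_succ]
        exact Fin.succ_lt_succ_iff.2
          ((I.orderEmbOfFin h).strictMono (Fin.succ_lt_succ_iff.1 hab))

theorem orderEmbOfFin_erase (I : Finset (Fin n)) (h : I.card = k + 1) (p : Fin (k + 1))
    (h' : (I.erase (I.orderEmbOfFin h p)).card = k) (r : Fin k) :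
    (I.erase (I.orderEmbOfFin h p)).orderEmbOfFin h' r = I.orderEmbOfFin h (p.succAbove r) := by
  have := Finset.orderEmbOfFin_unique h' (f := fun r => I.orderEmbOfFin h (p.succAbove r))
    (fun r => by simp [Finset.orderEmbOfFin_mem, Fin.succAbove_ne])
    (fun a b hab => (I.orderEmbOfFin h).strictMono (Fin.strictMono_succAbove p hab))
  exact (congrFun this r).symm

end OrderEmb

section Generic

variable {𝔽 : Type*} [Field 𝔽] {n k : ℕ}

/-! ### Weight functions -/

/-- The number `w(i, J)` for the reversed order. -/
def vIdx (i : Fin n) (J : Finset (Fin n)) : ℤ :=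
  -(((Finset.univ.filter fun j => j < i ∧ j ∉ J).card : ℕ) : ℤ) +
    (((Finset.univ.filter fun j => j < i ∧ j ∈ J).card : ℕ) : ℤ)

/-- The factor of the weight function for the reversed order. -/
def mFac (J : Finset (Fin n)) (lam t : 𝔽) (z : Fin n → 𝔽) (y : 𝔽) (i a : Fin n) : 𝔽 :=
  if i < a then t - z a + y
  else if a = i then lam + t - z a - (vIdx i J : 𝔽) * y
  else t - z a

/-- The symmetrization in the weight function for the reversed order. -/
def symSum (lam y : 𝔽) (z : Fin n → 𝔽) (t : Fin k → 𝔽) (J : Finset (Fin n)) (hJ : J.card = k) :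
    𝔽 :=
  ∑ τ : Equiv.Perm (Fin k),
    (∏ r, ∏ a, mFac J lam (t (τ r)) z y (J.orderEmbOfFin hJ r) a) *
      ∏ a, ∏ b ∈ Finset.Ioi a, gFac y (t (τ b)) (t (τ a))

theorem vIdx_upF (i : Fin n) (J : Finset (Fin n)) : vIdx i.succ (upF J) = vIdx i J - 1 := by
  simp only [vIdx, Fin.card_filter_univ_succ, Fin.succ_pos, zero_notMem_upF, Fin.succ_lt_succ_iff,
    succ_mem_upF]
  simp
  ring

theorem vIdx_insert_upF (i : Fin n) (J : Finset (Fin n)) :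
    vIdx i.succ (insert 0 (upF J)) = vIdx i J + 1 := by
  simp only [vIdx, Fin.card_filter_univ_succ, Fin.succ_pos, Fin.succ_lt_succ_iff,
    succ_mem_upF, Finset.mem_insert, Fin.succ_ne_zero, false_or, true_or]
  simp
  ring

/-- The new first point lies outside J and lowers `vIdx` by 1, which is absorbed as λ + y. If it
lies in J, as in `mFac_insert_upF`, the shift is λ - y. -/
theorem mFac_upF (J : Finset (Fin n)) (lam t : 𝔽) (z : Fin (n + 1) → 𝔽) (y : 𝔽) (i : Fin n) :
    ∏ a, mFac (upF J) lam t z y i.succ a =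
      (t - z 0) * ∏ a, mFac J (lam + y) t (Fin.tail z) y i a := by
  rw [Fin.prod_univ_succ]
  refine congrArg₂ (· * ·) ?_ (Finset.prod_congr rfl fun a _ => ?_)
  · simp [mFac, (Fin.succ_ne_zero i).symm]
  · simp only [mFac, Fin.succ_lt_succ_iff, Fin.succ_inj, vIdx_upF, Fin.tail]
    split_ifs
    · rfl
    · push_cast; ring
    · rfl

theorem mFac_insert_upF (J : Finset (Fin n)) (lam t : 𝔽) (z : Fin (n + 1) → 𝔽) (y : 𝔽)
    (i : Fin n) :
    ∏ a, mFac (insert 0 (upF J)) lam t z y i.succ a =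
      (t - z 0) * ∏ a, mFac J (lam - y) t (Fin.tail z) y i a := by
  rw [Fin.prod_univ_succ]
  refine congrArg₂ (· * ·) ?_ (Finset.prod_congr rfl fun a _ => ?_)
  · simp [mFac, (Fin.succ_ne_zero i).symm]
  · simp only [mFac, Fin.succ_lt_succ_iff, Fin.succ_inj, vIdx_insert_upF, Fin.tail]
    split_ifs
    · rfl
    · push_cast; ring
    · rfl

theorem mFac_insert_upF_zero (J : Finset (Fin n)) (lam t : 𝔽) (z : Fin (n + 1) → 𝔽) (y : 𝔽) :
    ∏ a, mFac (insert 0 (upF J)) lam t z y 0 a =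
      (lam + t - z 0) * ∏ a, (t - Fin.tail z a + y) := by
  rw [Fin.prod_univ_succ]
  refine congrArg₂ (· * ·) ?_ (Finset.prod_congr rfl fun a _ => ?_)
  · simp [mFac, vIdx]
  · simp [mFac, Fin.tail]

theorem symSum_upF (lam y : 𝔽) (z : Fin (n + 1) → 𝔽) (t : Fin k → 𝔽) (J : Finset (Fin n))
    (hJ : J.card = k) (hJ' : (upF J).card = k) :
    symSum lam y z t (upF J) hJ' =
      (∏ r, (t r - z 0)) * symSum (lam + y) y (Fin.tail z) t J hJ := by
  rw [symSum, symSum, Finset.mul_sum]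
  refine Finset.sum_congr rfl fun τ _ => ?_
  simp only [orderEmbOfFin_upF J hJ, mFac_upF, Finset.prod_mul_distrib]
  rw [Equiv.prod_comp τ (fun r => t r - z 0)]
  ring

/-- The point 0 is the least element of J, so it takes the variable t_p with p = τ(0); the sum over
τ is organized by p. -/
theorem symSum_insert_upF (lam y : 𝔽) (z : Fin (n + 1) → 𝔽) (t : Fin (k + 1) → 𝔽)
    (J : Finset (Fin n)) (hJ : J.card = k) (hJ' : (insert 0 (upF J)).card = k + 1) :
    symSum lam y z t (insert 0 (upF J)) hJ' =
      ∑ p, (lam + t p - z 0) * (∏ a, (t p - Fin.tail z a + y)) *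
        (∏ q, (t (p.succAbove q) - z 0)) * (∏ q, gFac y (t (p.succAbove q)) (t p)) *
        symSum (lam - y) y (Fin.tail z) (t ∘ p.succAbove) J hJ := by
  rw [symSum, sum_perm_fin_succ (F := fun τ => (∏ r, ∏ a, mFac (insert 0 (upF J)) lam (t (τ r)) z y
    ((insert 0 (upF J)).orderEmbOfFin hJ' r) a) *
      ∏ a, ∏ b ∈ Finset.Ioi a, gFac y (t (τ b)) (t (τ a)))]
  refine Finset.sum_congr rfl fun p _ => ?_
  rw [symSum, Finset.mul_sum]
  refine Finset.sum_congr rfl fun σ _ => ?_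
  rw [orderEmbOfFin_insert_upF J hJ hJ', Fin.prod_univ_succ, Fin.prod_univ_succ
    (f := fun a => ∏ b ∈ Finset.Ioi a, _)]
  simp only [Fin.cons_zero, Fin.cons_succ, mFac_insert_upF_zero, mFac_insert_upF,
    Finset.prod_mul_distrib, Fin.Ioi_zero_eq_map, ← Fin.map_succEmb_Ioi, Finset.prod_map,
    Fin.coe_succEmb]
  rw [Equiv.prod_comp σ (fun q => t (p.succAbove q) - z 0),
    Equiv.prod_comp σ (fun q => gFac y (t (p.succAbove q)) (t p))]
  simp only [Function.comp_apply]
  ring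

theorem prod_Ioi_rev {M : Type*} [CommMonoid M] (f : Fin k → Fin k → M) :
    ∏ a, ∏ b ∈ Finset.Ioi a, f a b = ∏ a, ∏ b ∈ Finset.Ioi a, f (Fin.rev b) (Fin.rev a) := by
  have h : ∀ g : Fin k → Fin k → M, ∏ a, ∏ b ∈ Finset.Ioi a, g a b =
      ∏ a, ∏ b, if a < b then g a b else 1 := by
    intro g
    refine Finset.prod_congr rfl fun a _ => ?_
    rw [← Finset.prod_filter]
    exact Finset.prod_congr (by ext; simp) fun _ _ => rfl
  rw [h, h, Finset.prod_comm, ← Equiv.prod_comp Fin.revPerm]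
  refine Finset.prod_congr rfl fun a _ => ?_
  rw [← Equiv.prod_comp Fin.revPerm]
  refine Finset.prod_congr rfl fun b _ => ?_
  simp [Fin.revPerm_apply, Fin.rev_lt_rev]

theorem orderEmbOfFin_map_rev (J : Finset (Fin n)) (h : J.card = k)
    (h' : (J.map (Fin.revPerm (n := n)).symm.toEmbedding).card = k) (r : Fin k) :
    (J.map (Fin.revPerm (n := n)).symm.toEmbedding).orderEmbOfFin h' r =
      (J.orderEmbOfFin h r.rev).rev := by
  have := Finset.orderEmbOfFin_unique h' (f := fun r => (J.orderEmbOfFin h r.rev).rev)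
    (fun r => Finset.mem_map.2 ⟨J.orderEmbOfFin h r.rev, Finset.orderEmbOfFin_mem _ _ _, rfl⟩)
    (fun a b hab => Fin.rev_lt_rev.2 ((J.orderEmbOfFin h).strictMono (Fin.rev_lt_rev.2 hab)))
  exact (congrFun this r).symm

theorem wIdx_rev (i : Fin n) (J : Finset (Fin n)) :
    wIdx i.rev (J.map (Fin.revPerm (n := n)).symm.toEmbedding) = vIdx i J := by
  have hmem : ∀ j : Fin n, j.rev ∈ J.map (Fin.revPerm (n := n)).symm.toEmbedding ↔ j ∈ J := by
    intro j
    rw [Finset.mem_map]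
    constructor
    · rintro ⟨a, ha, h⟩
      have h' : a.rev = j.rev := h
      rwa [← Fin.rev_injective h']
    · exact fun h => ⟨j, h, rfl⟩
  have key : ∀ P : Fin n → Prop, ∀ [DecidablePred P] [DecidablePred fun j : Fin n => P j.rev],
      (Finset.univ.filter P).card = (Finset.univ.filter fun j : Fin n => P j.rev).card := by
    intro P _ _
    refine Finset.card_bij' (fun a _ => a.rev) (fun a _ => a.rev) ?_ ?_ ?_ ?_ <;> simp
  rw [wIdx, vIdx, key, key (fun j => i.rev < j ∧ j ∈ _)]
  simp only [hmem, Fin.rev_lt_rev]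

theorem lFac_rev (J : Finset (Fin n)) (lam t : 𝔽) (z : Fin n → 𝔽) (y : 𝔽) (i a : Fin n) :
    lFac (J.map (Fin.revPerm (n := n)).symm.toEmbedding) lam t (fun a => z (Fin.revPerm a)) y
      i.rev a.rev = mFac J lam t z y i a := by
  simp only [lFac, mFac, Fin.rev_lt_rev, Fin.rev_inj, wIdx_rev, Fin.revPerm_apply, Fin.rev_rev]

/-- Reversing the points turns l_I into `mFac` and w into `vIdx`, and makes the first tensor factor
the first index of the product. -/
theorem weightMinus_eq (J : Finset (Fin n)) (hJ : J.card = k) (lam : 𝔽) (t : Fin k → 𝔽)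
    (z : Fin n → 𝔽) (y : 𝔽) :
    weightMinus J hJ lam t z y = (-1) ^ k / eFac t y *
      (y ^ k * symSum (-lam - ((n : 𝔽) - 2 * (k : 𝔽)) * y) y z t J hJ) := by
  rw [weightMinus, weightWσ, weightW, symSum]
  congr 2
  -- Reversal also reverses the enumeration of J, so τ is replaced by τ ∘ rev; this swaps the
  -- arguments of the factors over pairs.
  rw [← Equiv.sum_comp (Equiv.mulRight (Fin.revPerm (n := k)))]
  refine Finset.sum_congr rfl fun τ _ => ?_
  congr 1
  · rw [← Equiv.prod_comp Fin.revPerm]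
    refine Finset.prod_congr rfl fun r _ => ?_
    rw [← Equiv.prod_comp Fin.revPerm]
    refine Finset.prod_congr rfl fun a _ => ?_
    rw [orderEmbOfFin_map_rev J hJ]
    rw [← lFac_rev]
    simp only [Fin.revPerm_apply, Fin.rev_rev, Equiv.coe_mulRight, Equiv.Perm.mul_apply]
  · rw [prod_Ioi_rev (fun a b => (_ : 𝔽))]
    simp only [Fin.revPerm_apply, Fin.rev_rev, Equiv.coe_mulRight, Equiv.Perm.mul_apply, gFac]

/-! ### The vectors `ξ_I` through weight functions -/

/-- `∏_{a ∈ I} ∏_b (z_a - z_b + y)` -/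
def eqProd (y : 𝔽) (z : Fin n → 𝔽) (I : Finset (Fin n)) : 𝔽 := ∏ a ∈ I, ∏ b, (z a - z b + y)

theorem QFac_mul_eFac (y : 𝔽) (z : Fin n → 𝔽) (I : Finset (Fin n)) (h : I.card = k) :
    QFac I z y * eFac (fun r => z (I.orderEmbOfFin h r)) y = eqProd y z I := by
  have h1 : eFac (fun r => z (I.orderEmbOfFin h r)) y = ∏ a ∈ I, ∏ b ∈ I, (z a - z b + y) := by
    rw [eFac, prod_orderEmbOfFin I h fun a => ∏ s, (z a - z (I.orderEmbOfFin h s) + y)]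
    exact Finset.prod_congr rfl fun a _ => prod_orderEmbOfFin I h fun b => z a - z b + y
  rw [h1, QFac, eqProd, ← Finset.prod_mul_distrib]
  refine Finset.prod_congr rfl fun a _ => ?_
  rw [mul_comm, Finset.prod_mul_prod_compl]

theorem confOf_upF (J : Finset (Fin n)) : confOf (upF J) = Fin.cons 1 (confOf J) := by
  funext j
  induction j using Fin.cases <;> simp [confOf]

theorem confOf_insert_upF (J : Finset (Fin n)) :
    confOf (insert 0 (upF J)) = Fin.cons 0 (confOf J) := by
  funext j
  induction j using Fin.cases <;> simp [confOf, Fin.succ_ne_zero]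

theorem wtSum_confOf (J : Finset (Fin n)) : wtSum (confOf J) = 2 * J.card - n := by
  induction n with
  | zero => rw [Finset.eq_empty_of_isEmpty J]; simp [wtSum]
  | succ n ih =>
    induction J using finset_fin_succ_cases with
    | h0 J => rw [confOf_insert_upF, wtSum_cons, ih, card_insert_upF]; simp [wt]; ring
    | h1 J => rw [confOf_upF, wtSum_cons, ih, card_upF]; simp [wt]; ring

theorem prod_succAbove_eq_zero {p : Fin (k + 1)} (hp : p ≠ 0) {f : Fin (k + 1) → 𝔽}
    (h : f 0 = 0) : ∏ q, f (p.succAbove q) = 0 := by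
  obtain ⟨q, hq⟩ := Fin.exists_succAbove_eq hp.symm
  exact Finset.prod_eq_zero (Finset.mem_univ q) (by rw [hq, h])

theorem eqProd_upF (y : 𝔽) (z : Fin (n + 1) → 𝔽) (I : Finset (Fin n)) :
    eqProd y z (upF I) =
      (∏ a ∈ I, (z a.succ - z 0 + y)) * eqProd y (Fin.tail z) I := by
  rw [eqProd, prod_upF, eqProd, ← Finset.prod_mul_distrib]
  exact Finset.prod_congr rfl fun a _ => Fin.prod_univ_succ _

theorem eqProd_insert_upF (y : 𝔽) (z : Fin (n + 1) → 𝔽) (I : Finset (Fin n)) :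
    eqProd y z (insert 0 (upF I)) = y * (∏ b, (z 0 - Fin.tail z b + y)) *
      ((∏ a ∈ I, (z a.succ - z 0 + y)) * eqProd y (Fin.tail z) I) := by
  rw [eqProd, prod_insert_upF, Fin.prod_univ_succ, sub_self, zero_add, eqProd,
    ← Finset.prod_mul_distrib]
  congr 1
  exact Finset.prod_congr rfl fun a _ => Fin.prod_univ_succ _

theorem eqProd_ne_zero {y : 𝔽} {z : Fin n → 𝔽} (hzy : ∀ i j, z i - z j + y ≠ 0)
    (I : Finset (Fin n)) : eqProd y z I ≠ 0 :=
  Finset.prod_ne_zero_iff.2 fun _ _ => Finset.prod_ne_zero_iff.2 fun _ _ => hzy _ _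

/-- Both sides satisfy the same recursion in the first tensor factor. The argument -λ - (n - 2k) y
is what makes it work with a fixed λ: the change of n and k offsets the shift by ±y in `symSum`. -/
theorem eqProd_mul_xiRec (lam : 𝔽) {y : 𝔽} {z : Fin n → 𝔽}
    (hz : ∀ i j, i ≠ j → z i - z j ≠ 0) (hzy : ∀ i j, z i - z j + y ≠ 0)
    (I J : Finset (Fin n)) (hI : I.card = k) (hJ : J.card = k) :
    eqProd y z I * xiRec lam y z I (confOf J) =
      (-y) ^ k * symSum (-lam - ((n : 𝔽) - 2 * (k : 𝔽)) * y) y z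
        (fun r => z (I.orderEmbOfFin hI r)) J hJ := by
  induction n generalizing k with
  | zero =>
    obtain rfl : k = 0 := by rw [← hI, Finset.eq_empty_of_isEmpty I]; rfl
    obtain rfl := Finset.eq_empty_of_isEmpty I
    simp [eqProd, xiRec, symSum]
  | succ n ih =>
    have ih' := fun {k : ℕ} => ih (k := k) (z := Fin.tail z)
      (fun i j hij => hz i.succ j.succ (by simpa using hij)) (fun i j => hzy i.succ j.succ)
    have hz0 : ∀ i : Fin n, z i.succ - z 0 ≠ 0 := fun i => hz _ _ (Fin.succ_ne_zero i)
    have hzy0 : ∀ i : Fin n, z i.succ - z 0 + y ≠ 0 := fun i => hzy _ _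
    induction I using finset_fin_succ_cases with
    | h0 I =>
      obtain ⟨k, rfl⟩ : ∃ k', k = k' + 1 := ⟨I.card, by rw [← hI, card_insert_upF]⟩
      have hI' : I.card = k := by rw [card_insert_upF] at hI; omega
      have he := orderEmbOfFin_insert_upF I hI' hI
      induction J using finset_fin_succ_cases with
      | h0 J =>
        have hJ' : J.card = k := by rw [card_insert_upF] at hJ; omega
        rw [symSum_insert_upF _ _ _ _ _ hJ', Finset.sum_eq_single 0]
        · have ht : (fun r => z ((insert 0 (upF I)).orderEmbOfFin hI r)) ∘ Fin.succAbove 0 =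
              fun r => Fin.tail z (I.orderEmbOfFin hI' r) := by
            funext r; simp [he, Fin.tail]
          have ihIJ := ih' I J hI' hJ'
          rw [ht, xiRec_insert, confOf_insert_upF, vcons_cons_zero, eqProd_insert_upF, hI']
          simp only [he, Fin.cons_zero, Fin.succAbove_zero, Fin.cons_succ]
          rw [prod_orderEmbOfFin I hI' fun a => z a.succ - z 0,
            prod_orderEmbOfFin I hI' fun a => gFac y (z a.succ) (z 0)]
          have hprod : (∏ a ∈ I, (z a.succ - z 0)) * ∏ a ∈ I, gFac y (z a.succ) (z 0) =
              ∏ a ∈ I, (z a.succ - z 0 + y) := by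
            rw [← Finset.prod_mul_distrib]
            refine Finset.prod_congr rfl fun a _ => ?_
            have := hz0 a
            rw [gFac]; field_simp
          have hl : -lam - (((n + 1 : ℕ) : 𝔽) - 2 * ((k + 1 : ℕ) : 𝔽)) * y - y =
              -lam - ((n : 𝔽) - 2 * (k : 𝔽)) * y := by push_cast; ring
          rw [hl, ← hprod]
          rw [Pi.smul_apply, smul_eq_mul]
          push_cast
          linear_combination (y * (∏ b, (z 0 - Fin.tail z b + y)) *
            ((∏ a ∈ I, (z a.succ - z 0)) * ∏ a ∈ I, gFac y (z a.succ) (z 0)) *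
            (lam + ((n : 𝔽) - 1 - 2 * k) * y)) * ihIJ
        -- Here t_0 = z_0, and for p ≠ 0 the product of t_q - z_0 over q ≠ p contains the factor t_0
        -- - z_0 = 0.
        · intro p _ hp
          rw [prod_succAbove_eq_zero hp
            (f := fun q => z ((insert 0 (upF I)).orderEmbOfFin hI q) - z 0) (by simp [he])]
          simp
        · simp
      | h1 J =>
        have hJ' : J.card = k + 1 := by rwa [card_upF] at hJ
        -- All the t_r - z_0 occur, including t_0 - z_0 = 0, which matches the zero v_2-component of
        -- ξ_I for 0 ∈ I.
        rw [symSum_upF _ _ _ _ _ hJ', Finset.prod_eq_zero (Finset.mem_univ 0) (by simp [he]),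
          xiRec_insert, confOf_upF, vcons_cons_one]
        simp
    | h1 I =>
      have hI' : I.card = k := by rwa [card_upF] at hI
      induction J using finset_fin_succ_cases with
      | h0 J =>
        obtain ⟨k, rfl⟩ : ∃ k', k = k' + 1 := ⟨J.card, by rw [← hJ, card_insert_upF]⟩
        have hJ' : J.card = k := by rw [card_insert_upF] at hJ; omega
        rw [symSum_insert_upF _ _ _ _ _ hJ', xiRec_up, confOf_insert_upF, vcons_cons_zero,
          Finset.sum_apply, Finset.mul_sum, Finset.mul_sum, ← sum_orderEmbOfFin I hI']
        -- The variable assigned to the point 0 corresponds to the element p that the recursion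
        -- removes from I.
        refine Finset.sum_congr rfl fun r _ => ?_
        have hp : I.orderEmbOfFin hI' r ∈ I := Finset.orderEmbOfFin_mem _ _ _
        have hIp : (I.erase (I.orderEmbOfFin hI' r)).card = k := by
          rw [Finset.card_erase_of_mem hp, hI']; rfl
        have ihIJ := ih' _ J hIp hJ'
        have he := orderEmbOfFin_erase I hI' r hIp
        have ht : (fun r => z ((upF I).orderEmbOfFin hI r)) ∘ r.succAbove =
            fun q => Fin.tail z ((I.erase (I.orderEmbOfFin hI' r)).orderEmbOfFin hIp q) := by
          funext q; rw [he, Function.comp_apply, orderEmbOfFin_upF I hI']; rfl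
        rw [ht]
        simp only [orderEmbOfFin_upF I hI', ← he]
        rw [prod_orderEmbOfFin _ hIp fun a => z a.succ - z 0, Pi.smul_apply, smul_eq_mul]
        generalize hpe : I.orderEmbOfFin hI' r = p at *
        rw [prod_orderEmbOfFin _ hIp fun a => gFac y (z a.succ) (z p.succ), cCo_eq, eqProd_upF,
          eqProd, ← Finset.mul_prod_erase I _ hp, ← Finset.mul_prod_erase I _ hp, ← eqProd, hI']
        have hprod : (∏ a ∈ I.erase p, (z a.succ - z 0 + y)) *
            hProd y (z 0) (Fin.tail z) (I.erase p) = ∏ a ∈ I.erase p, (z a.succ - z 0) := by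
          rw [hProd, ← Finset.prod_mul_distrib]
          refine Finset.prod_congr rfl fun a _ => ?_
          have := hzy0 a
          rw [tail_apply]; field_simp
        have hl : -lam - (((n + 1 : ℕ) : 𝔽) - 2 * ((k + 1 : ℕ) : 𝔽)) * y - y =
            -lam - ((n : 𝔽) - 2 * (k : 𝔽)) * y := by push_cast; ring
        have hg : gProd y (Fin.tail z) I p = ∏ a ∈ I.erase p, gFac y (z a.succ) (z p.succ) := rfl
        rw [hl, ← hprod, ← hg, tail_apply]
        have h1 := hzy0 p
        generalize xiRec lam y (Fin.tail z) (I.erase p) (confOf J) = ξ at *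
        generalize symSum (-lam - ((n : 𝔽) - 2 * (k : 𝔽)) * y) y (Fin.tail z) _ J hJ' = T at *
        generalize eqProd y (Fin.tail z) (I.erase p) = e at *
        generalize ∏ a ∈ I.erase p, (z a.succ - z 0 + y) = A at *
        generalize ∏ b, (z p.succ - Fin.tail z b + y) = B at *
        push_cast
        field_simp
        linear_combination (y * (lam + ((n : 𝔽) + 1 - 2 * (k + 1)) * y - z p.succ + z 0) * A * B *
          hProd y (z 0) (Fin.tail z) (I.erase p) * gProd y (Fin.tail z) I p) * ihIJ
      | h1 J =>
        have hJ' : J.card = k := by rwa [card_upF] at hJ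
        have ihIJ := ih' I J hI' hJ'
        rw [symSum_upF _ _ _ _ _ hJ', xiRec_up, confOf_upF, vcons_cons_one, eqProd_upF]
        simp only [orderEmbOfFin_upF I hI']
        rw [prod_orderEmbOfFin I hI' fun a => z a.succ - z 0]
        have hprod : (∏ a ∈ I, (z a.succ - z 0 + y)) * hProd y (z 0) (Fin.tail z) I =
            ∏ a ∈ I, (z a.succ - z 0) := by
          rw [hProd, ← Finset.prod_mul_distrib]
          refine Finset.prod_congr rfl fun a _ => ?_
          have := hzy0 a
          rw [tail_apply]; field_simp
        have hl : -lam - (((n + 1 : ℕ) : 𝔽) - 2 * (k : 𝔽)) * y + y =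
            -lam - ((n : 𝔽) - 2 * (k : 𝔽)) * y := by push_cast; ring
        rw [hl, ← hprod, Pi.smul_apply, smul_eq_mul]
        have ht : (fun r => Fin.tail z (I.orderEmbOfFin hI' r)) =
            fun r => z (I.orderEmbOfFin hI' r).succ := rfl
        rw [ht] at ihIJ
        linear_combination ((∏ a ∈ I, (z a.succ - z 0 + y)) * hProd y (z 0) (Fin.tail z) I) * ihIJ

end Generic

section Generic

variable {𝔽 : Type*} [Field 𝔽] {n : ℕ}

/-! ### The determinant of `L_{22}` -/

/-- The matrix of `L_{22}`. -/
def mat22 (lam w y : 𝔽) (z : Fin n → 𝔽) : Matrix (Conf n) (Conf n) 𝔽 :=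
  Matrix.of fun t s => Lmat lam w y z (1, t) (1, s)

/-- The splitting of the basis according to the first tensor factor. -/
def confSumEquiv (n : ℕ) : Conf n ⊕ Conf n ≃ Conf (n + 1) where
  toFun := Sum.elim (fun s => Fin.cons 0 s) (fun s => Fin.cons 1 s)
  invFun s := if s 0 = 0 then Sum.inl (Fin.tail s) else Sum.inr (Fin.tail s)
  left_inv s := by cases s <;> simp
  right_inv s := by
    obtain ⟨b, s, rfl⟩ := exists_eq_cons s
    fin_cases b <;> simp

/-- By weight conservation, R reaches the output v_2 ⊗ v_2 only from v_2 ⊗ v_2. This gives the zero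
block. -/
theorem mat22_succ (lam w y : 𝔽) (z : Fin (n + 1) → 𝔽) :
    (mat22 lam w y z).submatrix (confSumEquiv n) (confSumEquiv n) =
      Matrix.fromBlocks
        (Matrix.diagonal (fun s : Conf n =>
          Rmat (lam - y * (wtSum s : 𝔽)) (w - z 0) y (1, 0) (1, 0)) * mat22 lam w y (Fin.tail z))
        (Matrix.of fun t s => Lmat lam w y z (1, Fin.cons 0 t) (1, Fin.cons 1 s)) 0
        (mat22 lam w y (Fin.tail z)) := by
  ext (t | t) (s | s)
  · simp [mat22, confSumEquiv, Lmat_succ, Fin.sum_univ_two, Rmat]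
  · simp [mat22, confSumEquiv]
  · simp [mat22, confSumEquiv, Lmat_succ, Fin.sum_univ_two, Rmat]
  · simp [mat22, confSumEquiv, Lmat_succ, Fin.sum_univ_two, Rmat]

/-- The determinant is a product of diagonal entries of R. An arbitrary submonoid is allowed so that
invertibility over ℒ[[w⁻¹]], not only nonvanishing, can be concluded. -/
theorem det_mat22_mem (lam w y : 𝔽) (z : Fin n → 𝔽) (U : Submonoid 𝔽)
    (hU : ∀ (l : ℤ) (j : Fin n), Rmat (lam - y * (l : 𝔽)) (w - z j) y (1, 0) (1, 0) ∈ U) :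
    (mat22 lam w y z).det ∈ U := by
  induction n with
  | zero =>
    have : mat22 lam w y z = 1 := by
      ext t s
      simp [mat22, Lmat_zero, Matrix.one_apply]
    rw [this, Matrix.det_one]
    exact U.one_mem
  | succ n ih =>
    have h := ih (Fin.tail z) fun l j => hU l j.succ
    rw [← Matrix.det_submatrix_equiv_self (confSumEquiv n), mat22_succ,
      Matrix.det_fromBlocks_zero₂₁, Matrix.det_mul, Matrix.det_diagonal]
    exact U.mul_mem (U.mul_mem (U.prod_mem fun s _ => hU _ _) h) h

end Generic

variable {n : ℕ}

/-! ### The parameters are generic -/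

theorem algebraMap_ne_zero_of_eval {p : MvPolynomial (Var n) ℂ} (f : Var n → ℂ)
    (h : MvPolynomial.eval f p ≠ 0) :
    algebraMap (MvPolynomial (Var n) ℂ) (RatFun n) p ≠ 0 := by
  intro h0
  have : p = 0 := IsFractionRing.injective (MvPolynomial (Var n) ℂ) (RatFun n)
    (by rw [h0, map_zero])
  exact h (by rw [this, map_zero])

theorem lamK_add_ne_zero (l : ℤ) : lamK n + (l : RatFun n) * yK n ≠ 0 := by
  have := algebraMap_ne_zero_of_eval (n := n)
    (p := MvPolynomial.X Var.lam + (l : MvPolynomial (Var n) ℂ) * MvPolynomial.X Var.y)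
    (fun v => match v with | Var.lam => 1 | _ => 0) (by simp)
  simpa [lamK, yK, rvar] using this

theorem yK_ne_zero : yK n ≠ 0 :=
  algebraMap_ne_zero_of_eval (fun _ => 1) (by simp)

theorem zK_sub_ne_zero {i j : Fin n} (h : i ≠ j) : zK i - zK j ≠ 0 := by
  have := algebraMap_ne_zero_of_eval (n := n)
    (p := MvPolynomial.X (Var.z i) - MvPolynomial.X (Var.z j))
    (fun v => match v with | Var.z k => if k = i then 1 else 0 | _ => 0) (by simp [h.symm])
  simpa [zK, rvar] using this

theorem zK_sub_add_ne_zero (i j : Fin n) : zK i - zK j + yK n ≠ 0 := by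
  have := algebraMap_ne_zero_of_eval (n := n)
    (p := MvPolynomial.X (Var.z i) - MvPolynomial.X (Var.z j) + MvPolynomial.X Var.y)
    (fun v => match v with | Var.y => 1 | _ => 0) (by simp)
  simpa [zK, yK, rvar] using this

theorem wS_sub_ne_zero (a : RatFun n) : wS n - cS a ≠ 0 :=
  left_ne_zero_of_mul_eq_one (mul_series a)

theorem generic_series :
    Generic (cS (lamK n)) (wS n) (cS (yK n)) (fun i => cS (zK i)) where
  y_ne := (map_ne_zero _).2 yK_ne_zero
  lam_ne l := by
    have := (map_ne_zero (cS (n := n))).2 (lamK_add_ne_zero l)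
    simpa using this
  w_ne i := wS_sub_ne_zero _
  wy_ne i := by rw [sub_sub, ← map_add]; exact wS_sub_ne_zero _
  z_ne i j h := by rw [← map_sub]; exact (map_ne_zero _).2 (zK_sub_ne_zero h)
  zy_ne i j := by rw [← map_sub, ← map_add]; exact (map_ne_zero _).2 (zK_sub_add_ne_zero i j)

/-! ### Invertibility of `L̃_{22}` -/

/-- The nonzero series that are invertible over `ℒ_{λ,(z,y)}`. -/
def unitSeries (n : ℕ) : Submonoid (WSeries n) where
  carrier := {u | u ≠ 0 ∧ u ∈ coeffSeries n ∧ u⁻¹ ∈ coeffSeries n}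
  one_mem' := ⟨one_ne_zero, one_mem _, by rw [inv_one]; exact one_mem _⟩
  mul_mem' := by
    rintro a b ⟨ha, ha1, ha2⟩ ⟨hb, hb1, hb2⟩
    exact ⟨mul_ne_zero ha hb, mul_mem ha1 hb1, by rw [mul_inv]; exact mul_mem ha2 hb2⟩

theorem inv_mem_unitSeries {u : WSeries n} (h : u ∈ unitSeries n) : u⁻¹ ∈ unitSeries n :=
  ⟨inv_ne_zero h.1, h.2.2, by rw [inv_inv]; exact h.2.1⟩

theorem lam_add_mem_unitSeries (l : ℤ) :
    cS (lamK n + (l : RatFun n) * yK n) ∈ unitSeries n :=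
  ⟨(map_ne_zero _).2 (lamK_add_ne_zero l),
    cS_mem (add_mem (lam_mem n) (mul_mem (Subalgebra.intCast_mem _ l) (zy_mem (yK_zy n)))),
    by rw [← map_inv₀]; exact cS_mem (inv_mem l)⟩

theorem div_mem_unitSeries {a b : RatFun n} (ha : a ∈ coeffAlg n) (hb : b ∈ coeffAlg n) :
    (wS n - cS a) / (wS n - cS b) ∈ unitSeries n := by
  have key : ∀ {a b : RatFun n}, a ∈ coeffAlg n → b ∈ coeffAlg n →
      (wS n - cS a) / (wS n - cS b) ∈ coeffSeries n := by
    intro a b ha hb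
    have h : (wS n - cS a) / (wS n - cS b) = 1 + cS (b - a) * (wS n - cS b)⁻¹ := by
      have := wS_sub_ne_zero b
      rw [map_sub]
      field_simp
      ring
    rw [h]
    exact add_mem (one_mem _) (mul_mem (cS_mem (sub_mem hb ha)) (inv_mem_series hb))
  exact ⟨div_ne_zero (wS_sub_ne_zero a) (wS_sub_ne_zero b), key ha hb, by
    rw [inv_div]; exact key hb ha⟩

theorem det_mat22_mem_unitSeries :
    (mat22 (cS (lamK n)) (wS n) (cS (yK n)) fun i => cS (zK i)).det ∈ unitSeries n := by
  refine det_mat22_mem _ _ _ _ _ fun l j => ?_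
  -- The entry is a quotient of two elements λ + l y, invertible in ℒ, times (w - z_j)/(w - z_j -
  -- y), whose constant term in w⁻¹ is 1.
  have h : Rmat (cS (lamK n) - cS (yK n) * (l : WSeries n)) (wS n - cS (zK j)) (cS (yK n))
      (1, 0) (1, 0) =
      cS (lamK n + ((-l - 1 : ℤ) : RatFun n) * yK n) *
        (cS (lamK n + ((-l : ℤ) : RatFun n) * yK n))⁻¹ *
        ((wS n - cS (zK j)) / (wS n - cS (zK j + yK n))) := by
    simp only [Rmat, map_add, map_mul, map_intCast]
    rw [mul_div_mul_comm, ← div_eq_mul_inv]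
    push_cast
    congr 2 <;> ring
  rw [h]
  exact mul_mem (mul_mem (lam_add_mem_unitSeries _) (inv_mem_unitSeries (lam_add_mem_unitSeries _)))
    (div_mem_unitSeries (zy_mem (zK_zy j)) (add_mem (zy_mem (zK_zy j)) (zy_mem (yK_zy n))))

/-- A power series over `ℒ_{λ,(z,y)}`, as a Laurent series. -/
def toSeries (n : ℕ) : PowerSeries (coeffAlg n) →+* WSeries n :=
  (HahnSeries.ofPowerSeries ℤ (RatFun n)).comp (PowerSeries.map (coeffAlg n).val.toRingHom)

theorem toSeries_injective : Function.Injective (toSeries n) := by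
  intro f g h
  have h' := HahnSeries.ofPowerSeries_injective (Γ := ℤ) (R := RatFun n) h
  refine PowerSeries.ext fun m => Subtype.ext ?_
  have h2 := congrArg (PowerSeries.coeff m) h'
  rwa [PowerSeries.coeff_map, PowerSeries.coeff_map] at h2

theorem coeff_toSeries (f : PowerSeries (coeffAlg n)) (m : ℕ) :
    (toSeries n f).coeff (m : ℤ) = (PowerSeries.coeff m f : coeffAlg n) := by
  rw [toSeries, RingHom.comp_apply, HahnSeries.ofPowerSeries_apply_coeff]
  simp

theorem Lentry_eq (i j : Fin 2) (t s : Conf n) :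
    Lentry i j t s = toSeries n (PowerSeries.mk fun m => Lcoeff i j m t s) := by
  obtain ⟨f, hf⟩ := Lentry_mem i j t s
  change toSeries n f = _ at hf
  rw [← hf]
  congr 1
  refine PowerSeries.ext fun m => Subtype.ext ?_
  rw [PowerSeries.coeff_mk]
  change _ = (Lentry i j t s).coeff (m : ℤ)
  rw [← hf, coeff_toSeries]

/-- The determinant is a unit of ℒ[[w⁻¹]]; setting w⁻¹ = 0 keeps it a unit. -/
theorem isUnit_det_Lcoeff :
    IsUnit (Matrix.of fun t s : Conf n => Lcoeff (n := n) 1 1 0 t s).det := by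
  set P : Matrix (Conf n) (Conf n) (PowerSeries (coeffAlg n)) :=
    Matrix.of fun t s => PowerSeries.mk fun m => Lcoeff 1 1 m t s with hP
  have h1 : mat22 (cS (lamK n)) (wS n) (cS (yK n)) (fun i => cS (zK i)) =
      (toSeries n).mapMatrix P :=
    Matrix.ext fun t s => Lentry_eq 1 1 t s
  obtain ⟨h0, -, q, hq⟩ := det_mat22_mem_unitSeries (n := n)
  change toSeries n q = _ at hq
  rw [h1, ← RingHom.map_det] at h0 hq
  have hu : IsUnit P.det := by
    refine IsUnit.of_mul_eq_one q (toSeries_injective ?_)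
    rw [map_mul, hq, map_one, mul_inv_cancel₀ h0]
  have h2 := hu.map (PowerSeries.constantCoeff (R := coeffAlg n))
  rw [RingHom.map_det] at h2
  convert! h2 using 2

theorem Ltilde_apply (i j : Fin 2) (m : ℕ) (ζ : V n) (t : Conf n) :
    Ltilde n i j m ζ t = ∑ s, Lcoeff i j m t s * shiftFor n j (ζ s) := rfl

/-- A power series is invertible once its constant term is, even over a noncommutative ring. The
constant term is an invertible matrix over ℒ composed with δ. -/
theorem isUnit_L22 : IsUnit (L22 n) := by
  rw [PowerSeries.isUnit_iff_constantCoeff, Module.End.isUnit_iff]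
  have h : ⇑(PowerSeries.constantCoeff (L22 n)) =
      (Matrix.of fun t s : Conf n => Lcoeff (n := n) 1 1 0 t s).mulVec ∘
        fun ζ s => shiftFor n 1 (ζ s) := by
    funext ζ t
    have : PowerSeries.constantCoeff (L22 n) = Ltilde n 1 1 0 := by
      rw [← PowerSeries.coeff_zero_eq_constantCoeff_apply]; simp [L22, LtildeSeries]
    rw [this, Ltilde_apply]
    rfl
  rw [h]
  refine Function.Bijective.comp ?_ ?_
  · have hdet := isUnit_det_Lcoeff (n := n)
    refine Function.bijective_iff_has_inverse.2 ⟨(Matrix.of fun t s : Conf n =>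
      Lcoeff (n := n) 1 1 0 t s)⁻¹.mulVec, fun v => ?_, fun v => ?_⟩
    · rw [Matrix.mulVec_mulVec, Matrix.nonsing_inv_mul _ hdet, Matrix.one_mulVec]
    · rw [Matrix.mulVec_mulVec, Matrix.mul_nonsing_inv _ hdet, Matrix.one_mulVec]
  · exact (Equiv.piCongrRight fun _ => (shiftFor n 1).toEquiv).bijective

/-! ### Compatibility with homomorphisms of fields -/

section Map

variable {𝔽 𝔾 : Type*} [Field 𝔽] [Field 𝔾]

theorem map_xiRec (φ : 𝔽 →+* 𝔾) (lam y : 𝔽) (z : Fin n → 𝔽) (I : Finset (Fin n)) (s : Conf n) :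
    φ (xiRec lam y z I s) = xiRec (φ lam) (φ y) (fun i => φ (z i)) I s := by
  induction n with
  | zero => exact map_one φ
  | succ n ih =>
    have ht : ∀ I s, φ (xiRec lam y (Fin.tail z) I s) =
        xiRec (φ lam) (φ y) (Fin.tail fun i => φ (z i)) I s := fun I s => ih _ _ _
    have h2 : φ 2 = 2 := map_ofNat φ 2
    obtain ⟨b, s, rfl⟩ := exists_eq_cons s
    induction I using finset_fin_succ_cases with
    | h0 I =>
      rw [xiRec_insert, xiRec_insert]
      fin_cases b
      · simp [ht, h2]
      · simp
    | h1 I =>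
      rw [xiRec_up, xiRec_up]
      fin_cases b
      · simp [ht, h2, cCo, hProd, gFac, Fin.tail]
      · simp [ht, hProd, Fin.tail]

end Map

/-! ### The vectors `xi` agree with the recursion. -/

theorem confOf_injective : Function.Injective (confOf (n := n)) := by
  intro J J' h
  ext j
  have := congrFun h j
  by_cases h1 : j ∈ J <;> by_cases h2 : j ∈ J' <;> simp_all [confOf]

theorem exists_confOf (s : Conf n) : ∃ J, confOf J = s := by
  refine ⟨Finset.univ.filter fun j => s j = 0, funext fun j => ?_⟩
  have : s j = 0 ∨ s j = 1 := by
    generalize s j = b; fin_cases b <;> simp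
  rcases this with h | h <;> simp [confOf, h]

theorem xi_confOf (I J : Finset (Fin n)) :
    ((xi I (confOf J) : coeffAlg n) : RatFun n) =
      if h : J.card = I.card then xiCoeffK I J h else 0 := by
  have h0 : xi I (confOf J) =
      if h : J.card = I.card then (⟨xiCoeffK I J h, xiCoeffK_mem I J h⟩ : coeffAlg n) else 0 := by
    rw [xi, Finset.sum_apply, Finset.sum_eq_single J]
    · split_ifs <;> simp [vBasis]
    · intro J' _ hJ
      split_ifs
      · simp [vBasis, confOf_injective.ne hJ.symm]
      · rfl
    · simp
  rw [h0]
  split_ifs <;> rfl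

theorem xi_eq_xiRec (I : Finset (Fin n)) (s : Conf n) :
    ((xi I s : coeffAlg n) : RatFun n) = xiRec (lamK n) (yK n) zK I s := by
  obtain ⟨J, rfl⟩ := exists_confOf s
  rw [xi_confOf]
  split_ifs with h
  · have hzy : ∀ i j : Fin n, zK i - zK j + yK n ≠ 0 := zK_sub_add_ne_zero
    have key := eqProd_mul_xiRec (lamK n) (z := zK) (fun i j => zK_sub_ne_zero) hzy I J rfl h
    have he := eqProd_ne_zero hzy I
    have hQ := QFac_mul_eFac (yK n) (zK (n := n)) I rfl
    rw [eq_comm, ← mul_right_inj' he, key, xiCoeffK, weightMinus_eq]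
    have hne := he
    rw [← hQ] at hne ⊢
    have h1 := left_ne_zero_of_mul hne
    have h2 := right_ne_zero_of_mul hne
    have hzs : zSub I = fun r => (zK : Fin n → RatFun n) (I.orderEmbOfFin rfl r) := rfl
    rw [neg_pow, hzs]
    generalize symSum (𝔽 := RatFun n) _ _ _ _ _ _ = S
    field_simp
  · rw [xiRec_eq_zero]
    rw [wtSum_confOf]
    intro h'; apply h; omega

/-! ### Shifts of series -/

/-- The action of a field automorphism on the coefficients of a series. -/
def mapSeries (σ : RatFun n →+* RatFun n) : WSeries n →+* WSeries n where
  toFun x := x.map σ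
  map_one' := HahnSeries.map_one σ.toMonoidWithZeroHom
  map_mul' x y := HahnSeries.map_mul σ.toNonUnitalRingHom
  map_zero' := by ext; simp
  map_add' x y := by ext; simp

theorem mapSeries_cS (σ : RatFun n →+* RatFun n) (a : RatFun n) :
    mapSeries σ (cS a) = cS (σ a) := HahnSeries.map_C a σ

theorem mapSeries_wS (σ : RatFun n →+* RatFun n) : mapSeries σ (wS n) = wS n := by
  have := HahnSeries.map_single (a := (-1 : ℤ)) (r := (1 : RatFun n)) σ.toZeroHom
  refine this.trans ?_
  simp [wS]

theorem mapSeries_ofPowerSeries (σ : RatFun n →+* RatFun n) (f : PowerSeries (RatFun n)) :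
    mapSeries σ (HahnSeries.ofPowerSeries ℤ _ f) =
      HahnSeries.ofPowerSeries ℤ _ (PowerSeries.map σ f) := by
  ext m
  change σ ((HahnSeries.ofPowerSeries ℤ _ f).coeff m) = _
  cases m with
  | ofNat m =>
    change σ ((HahnSeries.ofPowerSeries ℤ _ f).coeff (m : ℤ)) =
      (HahnSeries.ofPowerSeries ℤ _ _).coeff (m : ℤ)
    rw [HahnSeries.ofPowerSeries_apply_coeff, HahnSeries.ofPowerSeries_apply_coeff,
      PowerSeries.coeff_map]
  | negSucc m =>
    have h : ∀ g : PowerSeries (RatFun n),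
        (HahnSeries.ofPowerSeries ℤ _ g).coeff (Int.negSucc m) = 0 := by
      intro g
      rw [HahnSeries.ofPowerSeries_apply]
      refine HahnSeries.embDomain_of_notMem_range ?_
      rintro ⟨k, hk⟩
      have : (k : ℤ) = Int.negSucc m := hk
      omega
    rw [h, h, map_zero]

/-! ### Generating series of operators -/

/-- The action of a generating series of operators on a series of vectors. -/
def act (A : PowerSeries (Module.End ℂ (V n))) (v : ℕ → V n) : ℕ → V n := fun m =>
  ∑ p ∈ Finset.HasAntidiagonal.antidiagonal m, PowerSeries.coeff p.1 A (v p.2)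

/-- A vector, as a constant series. -/
def cst (ζ : V n) : ℕ → V n := fun m => if m = 0 then ζ else 0

theorem act_cst (A : PowerSeries (Module.End ℂ (V n))) (ζ : V n) (m : ℕ) :
    act A (cst ζ) m = PowerSeries.coeff m A ζ := by
  rw [act, Finset.sum_eq_single (m, 0)]
  · simp [cst]
  · rintro ⟨a, b⟩ hab hne
    have hb : b ≠ 0 := by
      rintro rfl
      apply hne
      simpa using hab
    simp [cst, hb]
  · simp

theorem act_one (v : ℕ → V n) : act 1 v = v := by
  funext m
  rw [act, Finset.sum_eq_single (0, m)]
  · simp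
  · rintro ⟨a, b⟩ hab hne
    have ha : a ≠ 0 := by
      rintro rfl
      apply hne
      simpa using hab
    simp [PowerSeries.coeff_one, ha]
  · simp

/-- Associativity of the Cauchy product, for operators that are only ℂ-linear because of δ. -/
theorem act_mul (A B : PowerSeries (Module.End ℂ (V n))) (v : ℕ → V n) :
    act (A * B) v = act A (act B v) := by
  funext m
  simp only [act, PowerSeries.coeff_mul, LinearMap.sum_apply, map_sum, Module.End.mul_apply,
    Finset.sum_sigma']
  refine Finset.sum_nbij' (fun ⟨⟨_i, j⟩, ⟨k, l⟩⟩ => ⟨(k, l + j), (l, j)⟩)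
    (fun ⟨⟨i, _j⟩, ⟨k, l⟩⟩ => ⟨(i + k, l), (i, k)⟩) ?_ ?_ ?_ ?_ ?_
  · rintro ⟨⟨a, b⟩, ⟨c, d⟩⟩ h
    simp only [Finset.mem_sigma, Finset.HasAntidiagonal.mem_antidiagonal] at h ⊢
    obtain ⟨rfl, rfl⟩ := h
    exact ⟨by ring, trivial⟩
  · rintro ⟨⟨a, b⟩, ⟨c, d⟩⟩ h
    simp only [Finset.mem_sigma, Finset.HasAntidiagonal.mem_antidiagonal] at h ⊢
    obtain ⟨rfl, rfl⟩ := h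
    exact ⟨by ring, trivial⟩
  · rintro ⟨⟨a, b⟩, ⟨c, d⟩⟩ h
    simp only [Finset.mem_sigma, Finset.HasAntidiagonal.mem_antidiagonal] at h
    obtain ⟨-, rfl⟩ := h
    rfl
  · rintro ⟨⟨a, b⟩, ⟨c, d⟩⟩ h
    simp only [Finset.mem_sigma, Finset.HasAntidiagonal.mem_antidiagonal] at h
    obtain ⟨-, rfl⟩ := h
    rfl
  · rintro ⟨⟨a, b⟩, ⟨c, d⟩⟩ h
    rfl

/-- A series of vectors, in coordinates. -/
def toW (v : ℕ → V n) : Conf n → WSeries n := fun t =>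
  HahnSeries.ofPowerSeries ℤ (RatFun n)
    (PowerSeries.mk fun m => ((v m t : coeffAlg n) : RatFun n))

theorem applySeries_eq (A : PowerSeries (Module.End ℂ (V n))) (ζ : V n) :
    applySeries A ζ = toW (act A (cst ζ)) := by
  funext t
  simp only [applySeries, toW, act_cst]

theorem toW_cst (ζ : V n) : toW (cst ζ) = constVec ζ := by
  funext t
  rw [toW, constVec, cS, ← HahnSeries.ofPowerSeries_C]
  congr 1
  ext m
  rw [PowerSeries.coeff_mk, PowerSeries.coeff_C, cst]
  split_ifs <;> simp

/-- The shift of `λ` that belongs to `L̃_{ij}`. -/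
def shiftHom (n : ℕ) (j : Fin 2) : RatFun n →+* RatFun n :=
  if j = 0 then ((shiftK n).symm : RatFun n →+* RatFun n) else (shiftK n : RatFun n →+* RatFun n)

theorem coe_shiftFor (j : Fin 2) (x : coeffAlg n) :
    ((shiftFor n j x : coeffAlg n) : RatFun n) = shiftHom n j x := by
  have h1 : ∀ x : coeffAlg n, ((shift n x : coeffAlg n) : RatFun n) = shiftK n x := fun _ => rfl
  rw [shiftFor, shiftHom]
  split_ifs
  · apply (shiftK n).injective
    rw [← h1]
    simp
  · exact h1 x

/-- This turns difference operators into linear algebra over the field of Laurent series: apply the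
shift to the coefficients, then the matrix L_{ij}. -/
theorem toW_act_Ltilde (i j : Fin 2) (v : ℕ → V n) (t : Conf n) :
    toW (act (LtildeSeries n i j) v) t =
      ∑ s, Lentry i j t s * mapSeries (shiftHom n j) (toW v s) := by
  simp only [toW, mapSeries_ofPowerSeries, Lentry_eq, toSeries, RingHom.comp_apply, ← map_mul,
    ← map_sum]
  congr 1
  refine PowerSeries.ext fun m => ?_
  rw [PowerSeries.coeff_mk, map_sum]
  simp only [PowerSeries.coeff_mul, PowerSeries.coeff_map, PowerSeries.coeff_mk, act]
  rw [Finset.sum_comm, Finset.sum_apply, AddSubmonoidClass.coe_finsetSum]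
  refine Finset.sum_congr rfl fun p _ => ?_
  rw [LtildeSeries, PowerSeries.coeff_mk, Ltilde_apply, AddSubmonoidClass.coe_finsetSum]
  refine Finset.sum_congr rfl fun s _ => ?_
  rw [MulMemClass.coe_mul, coe_shiftFor]
  rfl

/-! ### The action of `F̃` and `Ẽ` -/

instance : NeZero (2 : WSeries n) :=
  ⟨by rw [← map_ofNat (cS (n := n)) 2, map_ne_zero, ← map_ofNat (algebraMap ℂ (RatFun n)) 2,
    map_ne_zero]; exact two_ne_zero⟩

theorem constVec_xi (I : Finset (Fin n)) :
    constVec (xi I) = xiRec (cS (lamK n)) (cS (yK n)) (fun i => cS (zK i)) I :=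
  funext fun t => by rw [constVec, xi_eq_xiRec, map_xiRec]

theorem shiftHom_y (j : Fin 2) : shiftHom n j (yK n) = yK n := by
  fin_cases j
  · exact (shiftK n).symm_apply_eq.2 (shiftK_y n).symm
  · exact shiftK_y n

theorem shiftHom_z (j : Fin 2) (i : Fin n) : shiftHom n j (zK i) = zK i := by
  fin_cases j
  · exact (shiftK n).symm_apply_eq.2 (shiftK_z i).symm
  · exact shiftK_z i

theorem shiftHom_one_lam : shiftHom n 1 (lamK n) = lamK n + yK n := shiftK_lam n

theorem shiftHom_zero_lam : shiftHom n 0 (lamK n) = lamK n - yK n :=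
  (shiftK n).symm_apply_eq.2 (by rw [map_sub, shiftK_lam, shiftK_y, add_sub_cancel_right])

theorem mapSeries_constVec_one (I : Finset (Fin n)) (t : Conf n) :
    mapSeries (shiftHom n 1) (constVec (xi I) t) =
      xiRec (cS (lamK n) + cS (yK n)) (cS (yK n)) (fun i => cS (zK i)) I t := by
  simp only [constVec_xi, map_xiRec, mapSeries_cS, shiftHom_one_lam, shiftHom_y, shiftHom_z,
    map_add]

theorem mapSeries_constVec_zero (I : Finset (Fin n)) (t : Conf n) :
    mapSeries (shiftHom n 0) (constVec (xi I) t) =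
      xiRec (cS (lamK n) - cS (yK n)) (cS (yK n)) (fun i => cS (zK i)) I t := by
  simp only [constVec_xi, map_xiRec, mapSeries_cS, shiftHom_zero_lam, shiftHom_y, shiftHom_z,
    map_sub]

theorem sum_Lentry_xiRec (i : Fin 2) (I : Finset (Fin n)) (t : Conf n) :
    ∑ s, Lentry i 1 t s *
        xiRec (cS (lamK n) + cS (yK n)) (cS (yK n)) (fun i => cS (zK i)) I s =
      aEig (wS n) (cS (yK n)) (fun i => cS (zK i)) I *
        (![fVec (cS (lamK n)) (wS n) (cS (yK n)) (fun i => cS (zK i)) I,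
          xiRec (cS (lamK n)) (cS (yK n)) (fun i => cS (zK i)) I] : Fin 2 → Conf n → WSeries n)
          i t := by
  have h := congrFun (congrFun (Lop_xi generic_series I) i) t
  rw [Pi.smul_apply, Pi.smul_apply, smul_eq_mul] at h
  rw [← h]
  change _ = ∑ d, ∑ s, Lentry i d t s * _
  simp [Fin.sum_univ_two]

theorem sum_Lentry_eVec (I : Finset (Fin n)) (t : Conf n) :
    ∑ s, Lentry 1 0 t s *
        xiRec (cS (lamK n) - cS (yK n)) (cS (yK n)) (fun i => cS (zK i)) I s =
      ∑ s, Lentry 1 1 t s *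
        eVec (cS (lamK n)) (wS n) (cS (yK n)) (fun i => cS (zK i)) I s := by
  have h : ∑ d, ∑ s, Lentry 1 d t s * _ = _ :=
    congrFun (congrFun (Lop_eta generic_series I) 1) t
  simp only [Fin.sum_univ_two, Matrix.cons_val_zero, Matrix.cons_val_one, Pi.smul_apply,
    Pi.neg_apply, Pi.zero_apply, smul_zero, mul_neg, Finset.sum_neg_distrib] at h
  exact add_neg_eq_zero.1 h

theorem sum_Lentry_injective {u v : Conf n → WSeries n}
    (h : ∀ t, ∑ s, Lentry 1 1 t s * u s = ∑ s, Lentry 1 1 t s * v s) : u = v :=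
  Matrix.mulVec_injective_of_det_ne_zero det_mat22_mem_unitSeries.1 (funext h)

theorem aEig_ne_zero (I : Finset (Fin n)) :
    aEig (wS n) (cS (yK n)) (fun i => cS (zK i)) I ≠ 0 :=
  Finset.prod_ne_zero_iff.2 fun i _ =>
    div_ne_zero (generic_series.w_ne i) (generic_series.wy_ne i)

/-- L_{22} is injective over the field of series, so L̃_{22}⁻¹ ξ_I is identified from its image: its
shift is a_I⁻¹ ξ_I(λ + y). Applying L_{12} then cancels a_I. -/
theorem applySeries_Ftilde (I : Finset (Fin n)) :
    applySeries (Ftilde n) (xi I) =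
      fVec (cS (lamK n)) (wS n) (cS (yK n)) (fun i => cS (zK i)) I := by
  set v := act (Ring.inverse (L22 n)) (cst (xi I)) with hv
  have hact : act (L22 n) v = cst (xi I) := by
    rw [hv, ← act_mul, Ring.mul_inverse_cancel _ isUnit_L22, act_one]
  have ha := aEig_ne_zero I
  have hu : (fun s => mapSeries (shiftHom n 1) (toW v s)) =
      (aEig (wS n) (cS (yK n)) (fun i => cS (zK i)) I)⁻¹ •
        xiRec (cS (lamK n) + cS (yK n)) (cS (yK n)) (fun i => cS (zK i)) I := by
    refine sum_Lentry_injective fun t => ?_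
    rw [← toW_act_Ltilde]
    simp only [Pi.smul_apply, smul_eq_mul, mul_left_comm (Lentry _ _ _ _) _⁻¹]
    rw [← Finset.mul_sum, sum_Lentry_xiRec, inv_mul_cancel_left₀ ha]
    change toW (act (L22 n) v) t = _
    rw [hact, toW_cst, constVec_xi]
    rfl
  rw [applySeries_eq, Ftilde, act_mul, ← hv]
  funext t
  rw [L12, toW_act_Ltilde]
  simp only [funext_iff] at hu
  simp only [hu, Pi.smul_apply, smul_eq_mul, mul_left_comm (Lentry _ _ _ _) _⁻¹]
  rw [← Finset.mul_sum, sum_Lentry_xiRec, inv_mul_cancel_left₀ ha]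
  rfl

/-- L_{22} maps both sides to L̃_{21} ξ_I: the left one since L̃_{22} ∘ Ẽ = L̃_{21}, the right one
by `sum_Lentry_eVec`. The shift on the left is the δ inside L̃_{22}. -/
theorem mapSeries_applySeries_Etilde (I : Finset (Fin n)) :
    (fun t => mapSeries (shiftHom n 1) (applySeries (Etilde n) (xi I) t)) =
      eVec (cS (lamK n)) (wS n) (cS (yK n)) (fun i => cS (zK i)) I := by
  refine sum_Lentry_injective fun t => ?_
  rw [← sum_Lentry_eVec, applySeries_eq, ← toW_act_Ltilde]
  change toW (act (L22 n) _) t = _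
  rw [Etilde, ← act_mul, ← mul_assoc, Ring.mul_inverse_cancel _ isUnit_L22, one_mul, L21,
    toW_act_Ltilde]
  simp only [toW_cst, mapSeries_constVec_zero]

theorem gFac_cS (y a b : RatFun n) :
    gFac (cS y) (cS a) (cS b) = cS ((b - a - y) / (b - a)) := by
  simp only [gFac, map_div₀, map_sub]
  rw [← neg_div_neg_eq]
  congr 1 <;> ring

end DynGL2
end

/-! ### The proposition. -/

theorem mainTheorem9 (n : ℕ) :
    IsUnit (DynGL2.L22 n) ∧
    (∀ I : Finset (Fin n),
      DynGL2.applySeries (DynGL2.Ftilde n) (DynGL2.xi I) =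
        DynGL2.cS (-DynGL2.yK n) • ∑ i ∈ I,
          ((1 / (DynGL2.wS n - DynGL2.cS (DynGL2.zK i))) *
            (DynGL2.cS (DynGL2.lamK n) + DynGL2.wS n - DynGL2.cS (DynGL2.zK i) +
              DynGL2.cS (DynGL2.yK n) *
                ((n : DynGL2.WSeries n) - 2 * (I.card : DynGL2.WSeries n) + 1)) *
            ∏ s ∈ I.erase i,
              DynGL2.cS ((DynGL2.zK i - DynGL2.zK s - DynGL2.yK n) /
                (DynGL2.zK i - DynGL2.zK s))) •
          DynGL2.constVec (DynGL2.xi (I.erase i))) ∧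
    (∀ I : Finset (Fin n),
      DynGL2.applySeries (DynGL2.Etilde n) (DynGL2.xi I) =
        DynGL2.cS (-DynGL2.yK n *
            (1 / ((DynGL2.lamK n - DynGL2.yK n) * (DynGL2.lamK n - 2 * DynGL2.yK n)))) •
        ∑ i ∈ Iᶜ,
          ((1 / (DynGL2.wS n - DynGL2.cS (DynGL2.zK i))) *
            (DynGL2.cS (DynGL2.lamK n) - DynGL2.wS n + DynGL2.cS (DynGL2.zK i) -
              DynGL2.cS (DynGL2.yK n)) *
            ∏ s ∈ Iᶜ.erase i,
              DynGL2.cS ((DynGL2.zK s - DynGL2.zK i - DynGL2.yK n) /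
                (DynGL2.zK s - DynGL2.zK i))) •
          DynGL2.constVec (DynGL2.xi (insert i I))) := by
  refine ⟨DynGL2.isUnit_L22, fun I => ?_, fun I => ?_⟩
  · rw [DynGL2.applySeries_Ftilde, DynGL2.fVec, Finset.smul_sum]
    refine Finset.sum_congr rfl fun i _ => ?_
    rw [DynGL2.constVec_xi, smul_smul, DynGL2.fCo, DynGL2.gProd, map_neg]
    simp only [DynGL2.gFac_cS]
    congr 1
    ring
  · funext t
    -- Ẽ ξ_I is known after λ ↦ λ + y only, so both sides are shifted; c_E becomes -y / (λ (λ - y)).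
    apply (DynGL2.mapSeries (DynGL2.shiftHom n 1)).injective
    refine (congrFun (DynGL2.mapSeries_applySeries_Etilde I) t).trans ?_
    have hc : DynGL2.shiftHom n 1 (-DynGL2.yK n *
        (1 / ((DynGL2.lamK n - DynGL2.yK n) * (DynGL2.lamK n - 2 * DynGL2.yK n)))) =
        -DynGL2.yK n / (DynGL2.lamK n * (DynGL2.lamK n - DynGL2.yK n)) := by
      simp only [map_mul, map_neg, map_div₀, map_sub, map_one, map_ofNat,
        DynGL2.shiftHom_one_lam, DynGL2.shiftHom_y]
      rw [mul_one_div]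
      congr 2 <;> ring
    rw [DynGL2.eVec, Pi.smul_apply, Finset.sum_apply, Finset.sum_apply, smul_eq_mul, map_mul,
      DynGL2.mapSeries_cS, hc, map_sum, Finset.mul_sum]
    refine Finset.sum_congr rfl fun i _ => ?_
    rw [Pi.smul_apply, Pi.smul_apply, smul_eq_mul, smul_eq_mul, map_mul,
      DynGL2.mapSeries_constVec_one, ← mul_assoc, DynGL2.eCo]
    congr 1
    simp only [DynGL2.gFac_cS, map_mul, map_prod, map_div₀, map_sub, map_add, map_one, map_neg,
      DynGL2.mapSeries_cS, DynGL2.mapSeries_wS, DynGL2.shiftHom_one_lam, DynGL2.shiftHom_y,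
      DynGL2.shiftHom_z]
    ring
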